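/- **Definitions.** An *inverse monoid* is a monoid $S$ in which every $s$ has a unique inverse $s^{-1}$, i.e. a unique element with $ss^{-1}s=s$ and $s^{-1}ss^{-1}=s^{-1}$; $E(S)$ denotes its commutative submonoid of idempotents, $s\le t$ means $s=et$ for some $e\in E(S)$, and $\sigma$ is the congruence on $S$ generated by $\le$, so that $S/\sigma$ is the maximum group image of $S$. The inverse monoid $S$ is *$F$-inverse* if every $\sigma$-class has a unique maximum element, and a *max-generated* $F$-inverse monoid if moreover these maximum elements generate $S$. A *strict inverse $S$-module* is a triple $(A,\lambda,\alpha)$, where $A$ is a commutative inverse monoid, $\lambda\colon S\to\operatorname{End}A$ is a homomorphism of monoids into the monoid of semigroup endomorphisms of $A$, and $\alpha\colon E(S)\to E(A)$ is an isomorphism of monoids, such that $\lambda_e(a)=\alpha(e)a$ and $\lambda_s(\alpha(e))=\alpha(ses^{-1})$ for all $e\in E(S)$, $a\in A$, $s\in S$. A morphism $A\to A'$ is a semigroup homomorphism $\varphi$ with $\varphi\circ\alpha=\alpha'$ and $\varphi\circ\lambda_s=\lambda'_s\circ\varphi$ for all $s$; the strict inverse $S$-modules form an abelian category. Let $\mathbb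 Z_S=\{n_e\mid n\in\mathbb Z,\ e\in E(S)\}$ with $n_e+m_f=(n+m)_{ef}$, $\lambda_s(n_e)=n_{ses^{-1}}$, $\alpha(e)=0_e$. Lausch's cohomology groups are $H^n_S(A)=\operatorname{Ext}^n(\mathbb Z_S,A)$, computed in this category. Let $G$ be a group. A *partial $G$-module* is a commutative monoid $A$ with idempotents $1_x\in A$ and semigroup isomorphisms $\theta_x\colon A_{x^{-1}}\to A_x$, where $A_x=1_xA$ ($x\in G$), such that $A_1=A$, $\theta_1=\mathrm{id}_A$, $\theta_x(A_{x^{-1}}\cap A_y)=A_x\cap A_{xy}$, and $\theta_x\circ\theta_y=\theta_{xy}$ on $A_{y^{-1}}\cap A_{y^{-1}x^{-1}}$. It is *inverse* if $A$ is inverse and $E(A)$ is generated by the elements $1_x$, $x\in G$. Let $C^n(G,A)$ be the group, under pointwise multiplication, of functions $f$ on $G^n$ such that $f(x_1,\dots,x_n)$ is an invertible element of the ideal $A_{x_1}A_{x_1x_2}\cdots A_{x_1\cdots x_n}$ (for $n=0$: the invertible elements of $A$), and let $\delta^n\colon C^n(G,A)\to C^{n+1}(G,A)$ be given by $$(\delta^nf)(x_1,\dots,x_{n+1})=\theta_{x_1}\bigl(1_{x_1^{-1}}f(x_2,\dots,x_{n+1})\bigr)\prod_{i=1}^n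 f(x_1,\dots,x_ix_{i+1},\dots,x_{n+1})^{(-1)^i}\; f(x_1,\dots,x_n)^{(-1)^{n+1}},$$ inverses being taken in the corresponding ideals. The partial cohomology groups are $H^0(G,A)=\ker\delta^0$ and $H^n(G,A)=\ker\delta^n/\operatorname{im}\delta^{n-1}$ for $n\ge1$. **Statement.** Let $S$ be a max-generated $F$-inverse monoid, let $A$ be a strict inverse $S$-module, and let $G=S/\sigma$. Then there is a structure of an inverse partial $G$-module on the commutative monoid $A$ such that $H^n_S(A)\cong H^n(G,A)$ as abelian groups for all $n\ge 0$. -/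

import Mathlib

open CategoryTheory

universe u

namespace PartialCohomology

/-! ### Inverse semigroups -/

/-- A semigroup is inverse if every element `s` has a unique inverse, i.e. a unique `t` with
`s t s = s` and `t s t = t`. -/
class IsInverseSemigroup (S : Type*) [Semigroup S] : Prop where
  existsUnique_inverse : ∀ s : S, ∃! t : S, s * t * s = s ∧ t * s * t = t

section InverseSemigroup

variable {S : Type*} [Semigroup S] [IsInverseSemigroup S]

/-- The inverse `s⁻¹` of an element of an inverse semigroup. -/
noncomputable def sinv (s : S) : S :=
  (IsInverseSemigroup.existsUnique_inverse s).choose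

theorem mul_sinv_mul (s : S) : s * sinv s * s = s :=
  (IsInverseSemigroup.existsUnique_inverse s).choose_spec.1.1

theorem sinv_mul_sinv (s : S) : sinv s * s * sinv s = sinv s :=
  (IsInverseSemigroup.existsUnique_inverse s).choose_spec.1.2

theorem eq_sinv {s t : S} (h₁ : s * t * s = s) (h₂ : t * s * t = t) : t = sinv s :=
  (IsInverseSemigroup.existsUnique_inverse s).choose_spec.2 t ⟨h₁, h₂⟩

theorem sinv_sinv (s : S) : sinv (sinv s) = s :=
  (eq_sinv (sinv_mul_sinv s) (mul_sinv_mul s)).symm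

theorem idem_mul_sinv (s : S) : IsIdempotentElem (s * sinv s) := by
  unfold IsIdempotentElem
  rw [← mul_assoc, mul_sinv_mul]

theorem idem_sinv_mul (s : S) : IsIdempotentElem (sinv s * s) := by
  unfold IsIdempotentElem
  rw [← mul_assoc, sinv_mul_sinv]

theorem sinv_idem {e : S} (he : IsIdempotentElem e) : sinv e = e :=
  (eq_sinv (by rw [he.eq, he.eq]) (by rw [he.eq, he.eq])).symm

theorem idem_mul {e f : S} (he : IsIdempotentElem e) (hf : IsIdempotentElem f) :
    IsIdempotentElem (e * f) := by
  have he' : ∀ x, e * (e * x) = e * x := fun x => by rw [← mul_assoc, he.eq]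
  have hf' : ∀ x, f * (f * x) = f * x := fun x => by rw [← mul_assoc, hf.eq]
  have h1 := mul_sinv_mul (e * f)
  have h2 := sinv_mul_sinv (e * f)
  generalize sinv (e * f) = t at h1 h2
  simp only [mul_assoc] at h1 h2
  -- `f t e` is an inverse of `e f`, hence equals `t`; it is idempotent
  have h2' : ∀ x, t * (e * (f * (t * x))) = t * x := fun x => by
    simpa only [mul_assoc] using congrArg (· * x) h2
  have h3 : f * (t * e) = sinv (e * f) := eq_sinv
    (by simp only [mul_assoc, he', hf', h1])
    (by simp only [mul_assoc, he', hf', h2'])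
  have h4 : IsIdempotentElem (f * (t * e)) := by
    unfold IsIdempotentElem
    simp only [mul_assoc, h2']
  have h5 := sinv_idem h4
  rw [h3, sinv_sinv] at h5
  rw [h5, ← h3]
  exact h4

theorem idem_comm {e f : S} (he : IsIdempotentElem e) (hf : IsIdempotentElem f) :
    e * f = f * e := by
  have he' : ∀ x, e * (e * x) = e * x := fun x => by rw [← mul_assoc, he.eq]
  have hf' : ∀ x, f * (f * x) = f * x := fun x => by rw [← mul_assoc, hf.eq]
  have h1 := (idem_mul he hf).eq
  have h2 := (idem_mul hf he).eq
  simp only [mul_assoc] at h1 h2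
  have h : f * e = sinv (e * f) := eq_sinv
    (by simp only [mul_assoc, he', hf', h1]) (by simp only [mul_assoc, he', hf', h2])
  rw [h, sinv_idem (idem_mul he hf)]

theorem sinv_mul (s t : S) : sinv (s * t) = sinv t * sinv s := by
  have hc := idem_comm (idem_mul_sinv t) (idem_sinv_mul s)
  refine (eq_sinv ?_ ?_).symm
  · calc s * t * (sinv t * sinv s) * (s * t)
        = s * ((t * sinv t) * (sinv s * s)) * t := by simp only [mul_assoc]
      _ = (s * sinv s * s) * (t * sinv t * t) := by rw [hc]; simp only [mul_assoc]
      _ = s * t := by rw [mul_sinv_mul, mul_sinv_mul]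
  · calc sinv t * sinv s * (s * t) * (sinv t * sinv s)
        = sinv t * ((sinv s * s) * (t * sinv t)) * sinv s := by simp only [mul_assoc]
      _ = (sinv t * t * sinv t) * (sinv s * s * sinv s) := by rw [← hc]; simp only [mul_assoc]
      _ = sinv t * sinv s := by rw [sinv_mul_sinv, sinv_mul_sinv]

theorem idem_conj (s : S) {e : S} (he : IsIdempotentElem e) :
    IsIdempotentElem (s * e * sinv s) := by
  have hc := idem_comm he (idem_sinv_mul s)
  calc s * e * sinv s * (s * e * sinv s)
      = s * (e * (sinv s * s)) * (e * sinv s) := by simp only [mul_assoc]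
    _ = (s * sinv s * s) * (e * e) * sinv s := by rw [hc]; simp only [mul_assoc]
    _ = s * e * sinv s := by rw [mul_sinv_mul, he.eq]

theorem map_sinv {T : Type*} [Semigroup T] [IsInverseSemigroup T] (f : S →ₙ* T) (s : S) :
    f (sinv s) = sinv (f s) :=
  eq_sinv (by rw [← map_mul, ← map_mul, mul_sinv_mul])
    (by rw [← map_mul, ← map_mul, sinv_mul_sinv])

end InverseSemigroup

/-- For commutative semigroups, (von Neumann) regularity is enough. -/
theorem isInverseSemigroup_of_regular {A : Type*} [CommSemigroup A]
    (h : ∀ a : A, ∃ b, a * b * a = a) : IsInverseSemigroup A where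
  existsUnique_inverse a := by
    obtain ⟨b, hb⟩ := h a
    refine ⟨b * a * b, ⟨?_, ?_⟩, ?_⟩
    · calc a * (b * a * b) * a = (a * b * a) * b * a := by ac_rfl
        _ = a := by rw [hb, hb]
    · calc b * a * b * a * (b * a * b) = b * ((a * b * a) * b * a) * b := by ac_rfl
        _ = b * a * b := by rw [hb, hb]
    · rintro c ⟨h1, h2⟩
      calc c = c * a * c := h2.symm
        _ = c * (a * b * a) * c := by rw [hb]
        _ = b * a * (c * a * c) := by ac_rfl
        _ = b * a * c := by rw [h2]
        _ = b * (a * b * a) * c := by rw [hb]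
        _ = b * b * (a * c * a) := by ac_rfl
        _ = b * a * b := by rw [h1]; ac_rfl

/-! ### The semilattice of idempotents -/

/-- The set `E(S)` of idempotents of a semigroup. -/
def Idem (S : Type*) [Mul S] : Type _ := {e : S // IsIdempotentElem e}

namespace Idem

/-- `E(S)` is a commutative monoid if `S` is an inverse monoid. -/
instance {S : Type*} [Monoid S] [IsInverseSemigroup S] : CommMonoid (Idem S) where
  mul e f := ⟨e.1 * f.1, idem_mul e.2 f.2⟩
  one := ⟨1, IsIdempotentElem.one⟩
  mul_assoc e f g := Subtype.ext (mul_assoc e.1 f.1 g.1)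
  one_mul e := Subtype.ext (one_mul e.1)
  mul_one e := Subtype.ext (mul_one e.1)
  mul_comm e f := Subtype.ext (idem_comm e.2 f.2)

variable {S : Type*} [Monoid S] [IsInverseSemigroup S]

theorem val_mul (e f : Idem S) : (e * f).1 = e.1 * f.1 := rfl

theorem val_one : (1 : Idem S).1 = 1 := rfl

theorem mul_self (e : Idem S) : e * e = e := Subtype.ext e.2

/-- The idempotent `s e s⁻¹`. -/
noncomputable def conj (s : S) (e : Idem S) : Idem S := ⟨s * e.1 * sinv s, idem_conj s e.2⟩

theorem conj_mul (s : S) (e f : Idem S) : conj s (e * f) = conj s e * conj s f := by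
  apply Subtype.ext
  have hc := idem_comm (idem_sinv_mul s) e.2
  change s * (e.1 * f.1) * sinv s = s * e.1 * sinv s * (s * f.1 * sinv s)
  calc s * (e.1 * f.1) * sinv s = (s * sinv s * s) * e.1 * f.1 * sinv s := by
        rw [mul_sinv_mul]; simp only [mul_assoc]
    _ = s * ((sinv s * s) * e.1) * f.1 * sinv s := by simp only [mul_assoc]
    _ = s * e.1 * sinv s * (s * f.1 * sinv s) := by rw [hc]; simp only [mul_assoc]

theorem conj_conj (s t : S) (e : Idem S) : conj (s * t) e = conj s (conj t e) := by
  apply Subtype.ext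
  simp only [conj, sinv_mul, mul_assoc]

theorem conj_idem (e f : Idem S) : conj e.1 f = e * f := by
  apply Subtype.ext
  change e.1 * f.1 * sinv e.1 = e.1 * f.1
  rw [sinv_idem e.2, idem_comm e.2 f.2, mul_assoc, e.2.eq]

theorem conj_one_left (e : Idem S) : conj (1 : S) e = e := by
  rw [show (1 : S) = (1 : Idem S).1 from rfl, conj_idem, one_mul]

end Idem

/-! ### The minimum group congruence and `F`-inverse monoids -/

section FInverse

/-- The natural partial order of an inverse semigroup: `s ≤ t` iff `s = e t` for an idempotent
`e`. -/
def NatLE {S : Type*} [Mul S] (s t : S) : Prop := ∃ e : S, IsIdempotentElem e ∧ s = e * t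

variable (S : Type*) [Monoid S]

/-- The congruence `σ` generated by the natural partial order. -/
def sigma : Con S := conGen NatLE

/-- `m` is a maximum element of its `σ`-class. -/
def IsSigmaMax {S : Type*} [Monoid S] (m : S) : Prop := ∀ t : S, sigma S t m → NatLE t m

/-- An inverse monoid is `F`-inverse if each `σ`-class has a unique maximum element. -/
def IsFInverse : Prop := ∀ s : S, ∃! m : S, sigma S m s ∧ IsSigmaMax m

/-- `S` is max-generated if the maximum elements of the `σ`-classes generate `S`. -/
def IsMaxGenerated : Prop := Submonoid.closure {m : S | IsSigmaMax m} = ⊤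

/-- The quotient `S / σ`. -/
abbrev MaxGroupImage : Type _ := (sigma S).Quotient

theorem sigma_idem {S : Type*} [Monoid S] {e : S} (he : IsIdempotentElem e) : sigma S e 1 :=
  ConGen.Rel.of _ _ ⟨e, he, (mul_one e).symm⟩

/-- `S / σ` is a group (with the quotient multiplication), the maximum group image of `S`. -/
noncomputable instance [IsInverseSemigroup S] : Group (MaxGroupImage S) :=
  groupOfIsUnit fun x => by
    induction x using Con.induction_on with
    | H s =>
      exact ⟨⟨(s : (sigma S).Quotient), (sinv s : S),
        (Con.eq _).2 (sigma_idem (idem_mul_sinv s)),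
        (Con.eq _).2 (sigma_idem (idem_sinv_mul s))⟩, rfl⟩

end FInverse

/-! ### Modules over an inverse monoid -/

/-- A (unital) module `(A, λ, α)` over an inverse monoid `S`, on a commutative monoid `A`:
a homomorphism of monoids `λ` from `S` to the semigroup endomorphisms of `A` (which need not
preserve the identity) and a homomorphism of monoids `α : E(S) → E(A)` such that
`λ_e(a) = α(e) a` and `λ_s(α(e)) = α(s e s⁻¹)`. The values of `α` are automatically idempotent,
see `SModule.idem_alpha`. -/
structure SModule (S : Type*) [Monoid S] [IsInverseSemigroup S] (A : Type*) [CommMonoid A] where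
  lam : S → A →ₙ* A
  lam_one : ∀ a, lam 1 a = a
  lam_mul : ∀ s t a, lam (s * t) a = lam s (lam t a)
  alpha : Idem S →* A
  lam_idem : ∀ (e : Idem S) (a : A), lam e.1 a = alpha e * a
  lam_alpha : ∀ (s : S) (e : Idem S), lam s (alpha e) = alpha (Idem.conj s e)

namespace SModule

variable {S : Type*} [Monoid S] [IsInverseSemigroup S] {A : Type*} [CommMonoid A]

theorem idem_alpha (M : SModule S A) (e : Idem S) : IsIdempotentElem (M.alpha e) := by
  unfold IsIdempotentElem
  rw [← map_mul, Idem.mul_self]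

/-- A module is strict if `α : E(S) → E(A)` is an isomorphism. -/
structure IsStrict (M : SModule S A) : Prop where
  injective : Function.Injective M.alpha
  exists_alpha_eq : ∀ a : A, IsIdempotentElem a → ∃ e : Idem S, M.alpha e = a

end SModule

/-- A strict inverse `S`-module, i.e. a module over the inverse monoid `S` in the sense of Lausch:
the underlying commutative monoid is inverse and `α : E(S) → E(A)` is an isomorphism. -/
structure LauschMod (S : Type u) [Monoid S] [IsInverseSemigroup S] : Type (u + 1) where
  carrier : Type u
  [commMonoid : CommMonoid carrier]
  [isInverse : IsInverseSemigroup carrier]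
  str : SModule S carrier
  strict : str.IsStrict

namespace LauschMod

variable {S : Type u} [Monoid S] [IsInverseSemigroup S]

instance : CoeSort (LauschMod S) (Type u) := ⟨LauschMod.carrier⟩

instance (A : LauschMod S) : CommMonoid A := A.commMonoid

instance (A : LauschMod S) : IsInverseSemigroup A := A.isInverse

/-- The homomorphism `α : E(S) → A` of a strict inverse module. -/
abbrev alpha (A : LauschMod S) : Idem S →* A := A.str.alpha

/-- The endomorphism `λ_s` of a strict inverse module. -/
abbrev lam (A : LauschMod S) (s : S) : A →ₙ* A := A.str.lam s

/-- A morphism of modules: a homomorphism of semigroups commuting with `α` and `λ`. -/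
@[ext]
structure Hom (A B : LauschMod S) where
  toMulHom : A →ₙ* B
  map_alpha : ∀ e, toMulHom (A.alpha e) = B.alpha e
  map_lam : ∀ s a, toMulHom (A.lam s a) = B.lam s (toMulHom a)

/-- The category of strict inverse `S`-modules. -/
instance : Category (LauschMod S) where
  Hom A B := Hom A B
  id A := ⟨MulHom.id A, fun _ => rfl, fun _ _ => rfl⟩
  comp f g := ⟨g.toMulHom.comp f.toMulHom,
    fun e => by simp [f.map_alpha, g.map_alpha], fun s a => by simp [f.map_lam, g.map_lam]⟩

instance (A B : LauschMod S) : CoeFun (A ⟶ B) (fun _ => A → B) := ⟨fun f => f.toMulHom⟩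

section

variable {A B C : LauschMod S}

@[ext]
theorem hom_ext {f g : A ⟶ B} (h : ∀ a, f a = g a) : f = g :=
  Hom.ext (MulHom.ext h)

theorem comp_apply (f : A ⟶ B) (g : B ⟶ C) (a : A) : (f ≫ g) a = g (f a) := rfl

theorem id_apply (a : A) : (𝟙 A : A ⟶ A) a = a := rfl

theorem hom_mul (f : A ⟶ B) (a b : A) : f (a * b) = f a * f b := f.toMulHom.map_mul a b

theorem hom_alpha (f : A ⟶ B) (e : Idem S) : f (A.alpha e) = B.alpha e := f.map_alpha e

theorem hom_lam (f : A ⟶ B) (s : S) (a : A) : f (A.lam s a) = B.lam s (f a) := f.map_lam s a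

theorem hom_sinv (f : A ⟶ B) (a : A) : f (sinv a) = sinv (f a) := map_sinv f.toMulHom a

theorem hom_one (f : A ⟶ B) : f 1 = 1 := by
  rw [← map_one A.alpha, hom_alpha, map_one]

theorem sinv_mul_comm (a b : A) : sinv (a * b) = sinv a * sinv b := by
  rw [sinv_mul, mul_comm]

theorem alpha_injective (A : LauschMod S) : Function.Injective A.alpha := A.strict.injective

theorem exists_supp (a : A) : ∃ e : Idem S, A.alpha e = a * sinv a :=
  A.strict.exists_alpha_eq _ (idem_mul_sinv a)

/-- The idempotent `e` of `S` for which `a a⁻¹ = α(e)`, i.e. `a` lies in the component `A_e`. -/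
noncomputable def supp (a : A) : Idem S := (exists_supp a).choose

theorem alpha_supp (a : A) : A.alpha (supp a) = a * sinv a := (exists_supp a).choose_spec

theorem supp_eq {a : A} {e : Idem S} (h : A.alpha e = a * sinv a) : supp a = e :=
  A.alpha_injective ((alpha_supp a).trans h.symm)

theorem alpha_supp_mul (a : A) : A.alpha (supp a) * a = a := by
  rw [alpha_supp, mul_sinv_mul]

theorem supp_mul (a b : A) : supp (a * b) = supp a * supp b := by
  apply supp_eq
  rw [map_mul, alpha_supp, alpha_supp, sinv_mul_comm]
  ac_rfl

theorem supp_alpha (e : Idem S) : supp (A.alpha e) = e := by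
  apply supp_eq
  rw [sinv_idem (A.str.idem_alpha e), (A.str.idem_alpha e).eq]

theorem supp_sinv (a : A) : supp (sinv a) = supp a := by
  apply supp_eq
  rw [alpha_supp, sinv_sinv, mul_comm]

theorem supp_hom (f : A ⟶ B) (a : A) : supp (f a) = supp a := by
  apply supp_eq
  rw [← hom_alpha f, alpha_supp, hom_mul, hom_sinv]

theorem supp_lam (s : S) (a : A) : supp (A.lam s a) = Idem.conj s (supp a) := by
  apply supp_eq
  rw [← A.str.lam_alpha, alpha_supp, map_mul, map_sinv]

theorem alpha_mul_eq {e : Idem S} {a : A} (h : supp a = e) : A.alpha e * a = a := by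
  rw [← h, alpha_supp_mul]

theorem mul_alpha_eq {e : Idem S} {a : A} (h : supp a * e = supp a) : a * A.alpha e = a := by
  calc a * A.alpha e = A.alpha (supp a * e) * a := by
        rw [map_mul, mul_right_comm, alpha_supp_mul]
    _ = a := by rw [h, alpha_supp_mul]

/-! #### The preadditive structure -/

noncomputable instance : Zero (A ⟶ B) where
  zero := ⟨⟨fun a => B.alpha (supp a), fun a b => by rw [supp_mul, map_mul]⟩,
    fun e => by simp only [MulHom.coe_mk, supp_alpha],
    fun s a => by simp only [MulHom.coe_mk, supp_lam]; rw [B.str.lam_alpha]⟩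

noncomputable instance : Add (A ⟶ B) where
  add f g := ⟨⟨fun a => f a * g a, fun a b => by simp only [hom_mul]; ac_rfl⟩,
    fun e => by simp only [MulHom.coe_mk, hom_alpha]; exact B.str.idem_alpha e,
    fun s a => by simp only [MulHom.coe_mk, hom_lam, map_mul]⟩

noncomputable instance : Neg (A ⟶ B) where
  neg f := ⟨⟨fun a => sinv (f a), fun a b => by rw [hom_mul, sinv_mul_comm]⟩,
    fun e => by simp only [MulHom.coe_mk, hom_alpha, sinv_idem (B.str.idem_alpha e)],
    fun s a => by simp only [MulHom.coe_mk, hom_lam]; rw [map_sinv]⟩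

theorem zero_apply (a : A) : (0 : A ⟶ B) a = B.alpha (supp a) := rfl

theorem add_apply (f g : A ⟶ B) (a : A) : (f + g) a = f a * g a := rfl

theorem neg_apply (f : A ⟶ B) (a : A) : (-f) a = sinv (f a) := rfl

/-- The sum of two morphisms is `a ↦ f(a) g(a)`, and the zero morphism maps the component `A_e` to
the identity `α(e)` of `B_e`. -/
noncomputable instance : AddCommGroup (A ⟶ B) where
  add_assoc f g h := by ext a; simp only [add_apply, mul_assoc]
  zero_add f := by ext a; rw [add_apply, zero_apply, alpha_mul_eq (supp_hom f a)]
  add_zero f := by ext a; rw [add_apply, zero_apply, mul_comm, alpha_mul_eq (supp_hom f a)]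
  add_comm f g := by ext a; simp only [add_apply, mul_comm]
  neg_add_cancel f := by
    ext a
    rw [add_apply, neg_apply, zero_apply, mul_comm, ← alpha_supp, supp_hom]
  nsmul := nsmulRec
  zsmul := zsmulRec

end

noncomputable instance : Preadditive (LauschMod S) where
  add_comp A B C f g h := by ext a; simp only [comp_apply, add_apply, hom_mul]
  comp_add A B C f g h := by ext a; simp only [comp_apply, add_apply]

/-! #### Zero object and binary products -/

/-- The zero module, whose underlying monoid is `E(S)`. -/
noncomputable def zeroObject (S : Type u) [Monoid S] [IsInverseSemigroup S] : LauschMod S where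
  carrier := Idem S
  isInverse := isInverseSemigroup_of_regular fun e => ⟨e, by rw [Idem.mul_self, Idem.mul_self]⟩
  str :=
    { lam := fun s => ⟨Idem.conj s, Idem.conj_mul s⟩
      lam_one := Idem.conj_one_left
      lam_mul := Idem.conj_conj
      alpha := MonoidHom.id _
      lam_idem := Idem.conj_idem
      lam_alpha := fun _ _ => rfl }
  strict := ⟨Function.injective_id, fun a _ => ⟨a, rfl⟩⟩

theorem isZero_zeroObject : Limits.IsZero (zeroObject S) := by
  rw [Limits.IsZero.iff_id_eq_zero]
  ext e
  exact (supp_alpha (A := zeroObject S) e).symm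

instance : Limits.HasZeroObject (LauschMod S) := ⟨_, isZero_zeroObject⟩

/-- A submonoid containing `α(E(S))` and stable under inverses and `λ` is a strict inverse
module. -/
noncomputable def ofSubmonoid (A : LauschMod S) (N : Submonoid A)
    (hα : ∀ e, A.alpha e ∈ N) (hl : ∀ s, ∀ a ∈ N, A.lam s a ∈ N) (hi : ∀ a ∈ N, sinv a ∈ N) :
    LauschMod S where
  carrier := N
  isInverse := isInverseSemigroup_of_regular fun a =>
    ⟨⟨sinv a.1, hi _ a.2⟩, Subtype.ext (mul_sinv_mul a.1)⟩
  str :=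
    { lam := fun s => ⟨fun a => ⟨A.lam s a.1, hl s _ a.2⟩, fun a b => Subtype.ext (map_mul _ _ _)⟩
      lam_one := fun a => Subtype.ext (A.str.lam_one _)
      lam_mul := fun s t a => Subtype.ext (A.str.lam_mul _ _ _)
      alpha := A.alpha.codRestrict N hα
      lam_idem := fun e a => Subtype.ext (A.str.lam_idem _ _)
      lam_alpha := fun s e => Subtype.ext (A.str.lam_alpha _ _) }
  strict := ⟨fun e f h => A.alpha_injective (congrArg Subtype.val h), fun a ha => by
    obtain ⟨e, he⟩ := A.strict.exists_alpha_eq a.1 (congrArg Subtype.val ha)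
    exact ⟨e, Subtype.ext he⟩⟩

/-- The pairs of elements of two strict inverse modules in components with the same index. -/
def prodSubmonoid (A B : LauschMod S) : Submonoid (A × B) where
  carrier := {p : A × B | supp p.1 = supp p.2}
  one_mem' := by
    have h (C : LauschMod S) : supp (1 : C) = 1 := by rw [← map_one C.alpha, supp_alpha]
    exact (h A).trans (h B).symm
  mul_mem' := fun {p q} hp hq => by
    change supp (p.1 * q.1) = supp (p.2 * q.2)
    rw [supp_mul, supp_mul, show supp p.1 = supp p.2 from hp, show supp q.1 = supp q.2 from hq]

/-- The product of two strict inverse modules. -/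
noncomputable def prod (A B : LauschMod S) : LauschMod S where
  carrier := prodSubmonoid A B
  isInverse := isInverseSemigroup_of_regular fun p =>
    ⟨⟨(sinv p.1.1, sinv p.1.2), (supp_sinv _).trans (p.2.trans (supp_sinv _).symm)⟩,
      Subtype.ext (Prod.ext (mul_sinv_mul _) (mul_sinv_mul _))⟩
  str :=
    { lam := fun s => ⟨fun p => ⟨(A.lam s p.1.1, B.lam s p.1.2),
          (supp_lam _ _).trans ((congrArg _ p.2).trans (supp_lam _ _).symm)⟩,
        fun p q => Subtype.ext (Prod.ext (map_mul _ _ _) (map_mul _ _ _))⟩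
      lam_one := fun p => Subtype.ext (Prod.ext (A.str.lam_one _) (B.str.lam_one _))
      lam_mul := fun s t p => Subtype.ext (Prod.ext (A.str.lam_mul _ _ _) (B.str.lam_mul _ _ _))
      alpha := (A.alpha.prod B.alpha).codRestrict (prodSubmonoid A B)
        fun e => (supp_alpha e).trans (supp_alpha e).symm
      lam_idem := fun e p => Subtype.ext (Prod.ext (A.str.lam_idem _ _) (B.str.lam_idem _ _))
      lam_alpha := fun s e => Subtype.ext (Prod.ext (A.str.lam_alpha _ _) (B.str.lam_alpha _ _)) }
  strict := ⟨fun e f h => A.alpha_injective (congrArg (fun p => p.1.1) h), fun p hp => by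
    obtain ⟨e, he⟩ := A.strict.exists_alpha_eq p.1.1 (congrArg (fun p : prodSubmonoid A B => p.1.1) hp)
    obtain ⟨f, hf⟩ := B.strict.exists_alpha_eq p.1.2 (congrArg (fun p : prodSubmonoid A B => p.1.2) hp)
    have hef : e = f := by
      have h : supp p.1.1 = supp p.1.2 := p.2
      rwa [← he, ← hf, supp_alpha, supp_alpha] at h
    subst hef
    exact ⟨e, Subtype.ext (Prod.ext he hf)⟩⟩

instance : Limits.HasBinaryProducts (LauschMod S) := by
  have (A B : LauschMod S) : Limits.HasLimit (Limits.pair A B) := ⟨⟨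
    { cone := Limits.BinaryFan.mk (P := prod A B)
        (⟨⟨fun p => p.1.1, fun _ _ => rfl⟩, fun _ => rfl, fun _ _ => rfl⟩ : Hom (prod A B) A)
        (⟨⟨fun p => p.1.2, fun _ _ => rfl⟩, fun _ => rfl, fun _ _ => rfl⟩ : Hom (prod A B) B)
      isLimit := Limits.BinaryFan.isLimitMk
        (fun c =>
          (⟨⟨fun z => ⟨(c.fst z, c.snd z), (supp_hom c.fst z).trans (supp_hom c.snd z).symm⟩,
              fun z w => Subtype.ext (Prod.ext (hom_mul c.fst z w) (hom_mul c.snd z w))⟩,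
            fun e => Subtype.ext (Prod.ext (hom_alpha c.fst e) (hom_alpha c.snd e)),
            fun s z => Subtype.ext (Prod.ext (hom_lam c.fst s z) (hom_lam c.snd s z))⟩ :
            Hom c.pt (prod A B)))
        (fun c => rfl) (fun c => rfl)
        (fun c m h₁ h₂ => by
          ext z
          exact Subtype.ext (Prod.ext (congrArg (fun f : c.pt ⟶ A => f z) h₁)
            (congrArg (fun f : c.pt ⟶ B => f z) h₂))) }⟩⟩
  exact Limits.hasBinaryProducts_of_hasLimit_pair _

instance : Limits.HasFiniteProducts (LauschMod S) :=
  hasFiniteProducts_of_has_binary_and_terminal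

/-! #### Kernels and cokernels -/

section

variable {A B C : LauschMod S}

theorem congr_hom {f g : A ⟶ B} (h : f = g) (a : A) : f a = g a := by rw [h]

/-- A morphism with values in the image of an injective morphism factors through it. -/
noncomputable def liftInj (f : A ⟶ B) (hf : Function.Injective f) (k : C ⟶ B)
    (h : ∀ c, ∃ a, f a = k c) : C ⟶ A :=
  let key (g : C → A) (hg : ∀ c, f (g c) = k c) : Hom C A :=
    ⟨⟨g, fun c d => hf (by rw [hg, hom_mul, hom_mul, hg, hg])⟩,
      fun e => hf ((hg _).trans ((hom_alpha k e).trans (hom_alpha f e).symm)),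
      fun s c => hf ((hg _).trans ((hom_lam k s c).trans
        ((congrArg (B.lam s) (hg c)).symm.trans (hom_lam f s (g c)).symm)))⟩
  key (fun c => (h c).choose) fun c => (h c).choose_spec

theorem liftInj_comp (f : A ⟶ B) (hf : Function.Injective f) (k : C ⟶ B)
    (h : ∀ c, ∃ a, f a = k c) : liftInj f hf k h ≫ f = k := by
  ext c
  exact (h c).choose_spec

/-- A morphism which is compatible with a surjective morphism factors through it. -/
noncomputable def descSurj (f : A ⟶ B) (hf : Function.Surjective f) (k : A ⟶ C)
    (h : ∀ a a', f a = f a' → k a = k a') : B ⟶ C :=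
  have hc (b : B) : f (hf b).choose = b := (hf b).choose_spec
  (⟨⟨fun b => k (hf b).choose, fun b b' => by
      rw [← hom_mul]; exact h _ _ (by rw [hom_mul, hc, hc, hc])⟩,
    fun e => by
      rw [← hom_alpha k]; exact h _ _ (by rw [hc, hom_alpha]),
    fun s b => by
      simp only [MulHom.coe_mk]
      rw [← hom_lam k]; exact h _ _ (by rw [hom_lam, hc, hc])⟩ : Hom B C)

theorem comp_descSurj (f : A ⟶ B) (hf : Function.Surjective f) (k : A ⟶ C)
    (h : ∀ a a', f a = f a' → k a = k a') : f ≫ descSurj f hf k h = k := by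
  ext a
  exact h _ _ (hf (f a)).choose_spec

theorem mono_of_injective (f : A ⟶ B) (hf : Function.Injective f) : Mono f :=
  ⟨fun g h e => by ext z; exact hf (congr_hom e z)⟩

theorem epi_of_surjective (f : A ⟶ B) (hf : Function.Surjective f) : Epi f :=
  ⟨fun g h e => by ext z; obtain ⟨a, rfl⟩ := hf z; exact congr_hom e a⟩

/-- The kernel of a morphism: the elements mapped to idempotents. -/
noncomputable def ker (f : A ⟶ B) : LauschMod S :=
  ofSubmonoid A
    { carrier := {a | f a = B.alpha (supp a)}
      one_mem' := by
        change f 1 = B.alpha (supp 1)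
        rw [hom_one, ← map_one A.alpha, supp_alpha, map_one]
      mul_mem' := fun {a b} ha hb => by
        change f (a * b) = B.alpha (supp (a * b))
        rw [hom_mul, supp_mul, map_mul, show f a = _ from ha, show f b = _ from hb] }
    (fun e => by
      change f (A.alpha e) = B.alpha (supp (A.alpha e))
      rw [hom_alpha, supp_alpha])
    (fun s a ha => by
      change f (A.lam s a) = B.alpha (supp (A.lam s a))
      rw [hom_lam, supp_lam, ← B.str.lam_alpha, show f a = _ from ha])
    (fun a ha => by
      change f (sinv a) = B.alpha (supp (sinv a))
      rw [hom_sinv, supp_sinv, show f a = _ from ha, sinv_idem (B.str.idem_alpha _)])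

/-- The inclusion of the kernel. -/
noncomputable def kerι (f : A ⟶ B) : ker f ⟶ A :=
  (⟨⟨fun a => a.1, fun _ _ => rfl⟩, fun _ => rfl, fun _ _ => rfl⟩ : Hom (ker f) A)

theorem kerι_injective (f : A ⟶ B) : Function.Injective (kerι f) := fun _ _ h => Subtype.ext h

theorem exists_kerι (f : A ⟶ B) {a : A} (ha : f a = B.alpha (supp a)) : ∃ k, kerι f k = a :=
  ⟨⟨a, ha⟩, rfl⟩

theorem kerι_comp (f : A ⟶ B) : kerι f ≫ f = 0 := by
  ext a
  rw [zero_apply, ← supp_hom (kerι f)]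
  exact a.2

instance : Limits.HasKernels (LauschMod S) where
  has_limit {A B} f := ⟨⟨
    { cone := Limits.KernelFork.ofι (kerι f) (kerι_comp f)
      isLimit := Limits.KernelFork.IsLimit.ofι _ _
        (fun k hk => liftInj (kerι f) (kerι_injective f) k fun c =>
          exists_kerι f (by rw [← comp_apply, hk, zero_apply, supp_hom]))
        (fun k hk => liftInj_comp _ _ _ _)
        (fun k hk m hm => by
          have := mono_of_injective _ (kerι_injective f)
          rw [← cancel_mono (kerι f), hm, liftInj_comp]) }⟩⟩

/-- The congruence on `B` whose classes are the cosets, within each component of `B`, of the image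
of `f : A ⟶ B`. -/
def cokerCon (f : A ⟶ B) : Con B where
  r b b' := supp b = supp b' ∧ ∃ a, b = b' * f a
  iseqv :=
    { refl := fun b => ⟨rfl, A.alpha (supp b), by
        rw [hom_alpha, mul_comm, alpha_supp_mul]⟩
      symm := by
        rintro b b' ⟨h, a, rfl⟩
        refine ⟨h.symm, sinv a, ?_⟩
        rw [supp_mul, supp_hom] at h
        rw [mul_assoc, ← hom_mul, ← alpha_supp, hom_alpha, mul_alpha_eq h]
      trans := by
        rintro b b' b'' ⟨h, a, rfl⟩ ⟨h', a', rfl⟩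
        exact ⟨h.trans h', a' * a, by rw [hom_mul, mul_assoc]⟩ }
  mul' := by
    rintro b b' c c' ⟨h, a, rfl⟩ ⟨h', a', rfl⟩
    exact ⟨by rw [supp_mul, h, h', supp_mul], a * a', by rw [hom_mul]; ac_rfl⟩

theorem cokerCon_idem (f : A ⟶ B) {b : B} (h : cokerCon f (b * b) b) :
    cokerCon f b (B.alpha (supp b)) := by
  obtain ⟨-, a, h⟩ := h
  refine ⟨(supp_alpha _).symm, a, ?_⟩
  calc b = b * b * sinv b := by rw [mul_assoc, mul_comm, ← alpha_supp, alpha_supp_mul]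
    _ = B.alpha (supp b) * f a := by rw [h, alpha_supp]; ac_rfl

/-- The cokernel of a morphism. -/
noncomputable def coker (f : A ⟶ B) : LauschMod S where
  carrier := (cokerCon f).Quotient
  isInverse := isInverseSemigroup_of_regular fun x => by
    induction x using Con.induction_on with
    | H b => exact ⟨(sinv b : B), by rw [← Con.coe_mul, ← Con.coe_mul, mul_sinv_mul]⟩
  str :=
    { lam := fun s => ⟨fun x => Con.liftOn x (fun b => (B.lam s b : (cokerCon f).Quotient))
          (by
            rintro b b' ⟨h, a, rfl⟩
            refine (Con.eq _).2 ⟨by rw [supp_lam, h, supp_lam], A.lam s a, ?_⟩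
            rw [map_mul, hom_lam]),
        fun x y => by
          induction x, y using Con.induction_on₂ with
          | H b c => exact congrArg _ (map_mul (B.lam s) b c)⟩
      lam_one := fun x => by
        induction x using Con.induction_on with
        | H b => exact congrArg _ (B.str.lam_one b)
      lam_mul := fun s t x => by
        induction x using Con.induction_on with
        | H b => exact congrArg _ (B.str.lam_mul s t b)
      alpha := (cokerCon f).mk'.comp B.alpha
      lam_idem := fun e x => by
        induction x using Con.induction_on with
        | H b => exact congrArg _ (B.str.lam_idem e b)
      lam_alpha := fun s e => congrArg _ (B.str.lam_alpha s e) }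
  strict := ⟨fun e e' h => by
      have := ((Con.eq _).1 h).1
      rwa [supp_alpha, supp_alpha] at this,
    fun x hx => by
      induction x using Con.induction_on with
      | H b => exact ⟨supp b, ((Con.eq _).2 (cokerCon_idem f ((Con.eq _).1 hx))).symm⟩⟩

/-- The projection to the cokernel. -/
noncomputable def cokerπ (f : A ⟶ B) : B ⟶ coker f :=
  (⟨⟨fun b => (b : (cokerCon f).Quotient), fun _ _ => rfl⟩, fun _ => rfl, fun _ _ => rfl⟩ :
    Hom B (coker f))

theorem cokerπ_surjective (f : A ⟶ B) : Function.Surjective (cokerπ f) := fun x => by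
  induction x using Con.induction_on with
  | H b => exact ⟨b, rfl⟩

theorem cokerπ_eq (f : A ⟶ B) {b b' : B} :
    cokerπ f b = cokerπ f b' ↔ supp b = supp b' ∧ ∃ a, b = b' * f a := Con.eq (cokerCon f)

theorem comp_cokerπ (f : A ⟶ B) : f ≫ cokerπ f = 0 := by
  ext a
  rw [zero_apply, comp_apply, ← hom_alpha (cokerπ f), cokerπ_eq]
  exact ⟨by rw [supp_hom, supp_alpha], a, by rw [alpha_mul_eq (supp_hom f a)]⟩

instance : Limits.HasCokernels (LauschMod S) where
  has_colimit {A B} f := ⟨⟨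
    { cocone := Limits.CokernelCofork.ofπ (cokerπ f) (comp_cokerπ f)
      isColimit := Limits.CokernelCofork.IsColimit.ofπ _ _
        (fun k hk => descSurj (cokerπ f) (cokerπ_surjective f) k fun b b' h => by
          obtain ⟨h, a, rfl⟩ := (cokerπ_eq f).1 h
          rw [supp_mul, supp_hom] at h
          rw [hom_mul, ← comp_apply, hk, zero_apply, mul_alpha_eq (by rw [supp_hom, h])])
        (fun k hk => comp_descSurj _ _ _ _)
        (fun k hk m hm => by
          have := epi_of_surjective _ (cokerπ_surjective f)
          rw [← cancel_epi (cokerπ f), hm, comp_descSurj]) }⟩⟩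

/-! #### The category is abelian -/

theorem injective_of_mono (f : A ⟶ B) [Mono f] : Function.Injective f := by
  intro a a' h
  have h0 : kerι f = 0 := by
    rw [← cancel_mono f, kerι_comp, Limits.zero_comp]
  have hs : supp a = supp a' := by rw [← supp_hom f, h, supp_hom]
  obtain ⟨k, hk⟩ := exists_kerι f (a := a * sinv a') (by
    rw [hom_mul, hom_sinv, h, ← alpha_supp, supp_hom, supp_mul, supp_sinv, hs, Idem.mul_self])
  rw [h0, zero_apply] at hk
  have hk' : supp k = supp a' := by
    have := congrArg supp hk
    rwa [supp_alpha, supp_mul, supp_sinv, hs, Idem.mul_self] at this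
  calc a = A.alpha (supp a') * a := (alpha_mul_eq hs).symm
    _ = a * sinv a' * a' := by rw [alpha_supp]; ac_rfl
    _ = a' := by rw [← hk, hk', alpha_supp_mul]

theorem surjective_of_epi (f : A ⟶ B) [Epi f] : Function.Surjective f := by
  intro b
  have h0 : cokerπ f = 0 := by
    rw [← cancel_epi f, comp_cokerπ, Limits.comp_zero]
  have h : cokerπ f b = cokerπ f (B.alpha (supp b)) := by
    rw [hom_alpha, h0, zero_apply]
  obtain ⟨-, a, h⟩ := (cokerπ_eq f).1 h
  exact ⟨A.alpha (supp b) * a, by rw [hom_mul, hom_alpha, ← h]⟩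

instance : IsNormalMonoCategory (LauschMod S) where
  normalMonoOfMono {A B} f _ := ⟨
    { Z := coker f
      g := cokerπ f
      w := comp_cokerπ f
      isLimit := Limits.KernelFork.IsLimit.ofι _ _
        (fun k hk => liftInj f (injective_of_mono f) k fun c => by
          have h : cokerπ f (k c) = cokerπ f (B.alpha (supp c)) := by
            rw [← comp_apply, hk, zero_apply, hom_alpha]
          obtain ⟨-, a, h⟩ := (cokerπ_eq f).1 h
          exact ⟨A.alpha (supp c) * a, by rw [hom_mul, hom_alpha, ← h]⟩)
        (fun k hk => liftInj_comp _ _ _ _)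
        (fun k hk m hm => by rw [← cancel_mono f, hm, liftInj_comp]) }⟩

instance : IsNormalEpiCategory (LauschMod S) where
  normalEpiOfEpi {A B} f _ := ⟨
    { W := ker f
      g := kerι f
      w := kerι_comp f
      isColimit := Limits.CokernelCofork.IsColimit.ofπ _ _
        (fun k hk => descSurj f (surjective_of_epi f) k fun a a' h => by
          have hs : supp a = supp a' := by rw [← supp_hom f, h, supp_hom]
          obtain ⟨c, hc⟩ := exists_kerι f (a := a * sinv a') (by
            rw [hom_mul, hom_sinv, h, ← alpha_supp, supp_hom, supp_mul, supp_sinv, hs,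
              Idem.mul_self])
          have h1 : k (a * sinv a') = k (A.alpha (supp a')) := by
            rw [← hc, ← comp_apply, hk, zero_apply, hom_alpha, ← supp_hom (kerι f), hc, supp_mul,
              supp_sinv, hs, Idem.mul_self]
          calc k a = k (A.alpha (supp a') * a) := by rw [alpha_mul_eq hs]
            _ = k (a * sinv a') * k a' := by rw [alpha_supp, ← hom_mul]; congr 1; ac_rfl
            _ = k a' := by rw [h1, ← hom_mul, alpha_supp_mul])
        (fun k hk => comp_descSurj _ _ _ _)
        (fun k hk m hm => by rw [← cancel_epi f, hm, comp_descSurj]) }⟩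

end

/-- The category of strict inverse `S`-modules is abelian. -/
noncomputable instance : Abelian (LauschMod S) where

instance : HasExt.{u + 1} (LauschMod S) := HasExt.standard _

/-! #### The trivial module and the cohomology groups -/

/-- The trivial strict inverse module `ℤ_S`. It consists of symbols `n_e` with `n : ℤ` and
`e ∈ E(S)`, such that `n_e + m_f = (n + m)_{ef}`, `λ_s(n_e) = n_{s e s⁻¹}` and `α(e) = 0_e`. -/
noncomputable def trivialModule (S : Type u) [Monoid S] [IsInverseSemigroup S] : LauschMod S where
  carrier := Multiplicative ℤ × Idem S
  isInverse := isInverseSemigroup_of_regular fun a => ⟨(a.1⁻¹, a.2), by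
    refine Prod.ext ?_ ?_
    · change a.1 * a.1⁻¹ * a.1 = a.1
      rw [mul_inv_cancel, one_mul]
    · change a.2 * a.2 * a.2 = a.2
      rw [Idem.mul_self, Idem.mul_self]⟩
  str :=
    { lam := fun s => ⟨fun a => (a.1, Idem.conj s a.2),
        fun a b => Prod.ext rfl (Idem.conj_mul s a.2 b.2)⟩
      lam_one := fun a => Prod.ext rfl (Idem.conj_one_left a.2)
      lam_mul := fun s t a => Prod.ext rfl (Idem.conj_conj s t a.2)
      alpha := MonoidHom.inr (Multiplicative ℤ) (Idem S)
      lam_idem := fun e a => Prod.ext (one_mul a.1).symm (Idem.conj_idem e a.2)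
      lam_alpha := fun _ _ => rfl }
  strict := ⟨fun e f h => congrArg Prod.snd h, fun a ha => ⟨a.2, Prod.ext (by
    have h : a.1 * a.1 = a.1 := congrArg Prod.fst ha
    exact (mul_eq_left.1 h).symm) rfl⟩⟩

end LauschMod

/-- The strict inverse module given by an inverse commutative monoid `A` and a strict `S`-module
structure on `A`, as an object of the category of strict inverse modules. -/
abbrev SModule.IsStrict.toLauschMod {S : Type u} [Monoid S] [IsInverseSemigroup S] {A : Type u}
    [CommMonoid A] [IsInverseSemigroup A] {M : SModule S A} (hM : M.IsStrict) : LauschMod S where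
  carrier := A
  str := M
  strict := hM

/-- Lausch's cohomology `H^n_S(A) = Ext^n_S(ℤ_S, A)` of an inverse monoid `S` with values in a
strict inverse `S`-module `A`, where `Ext` is taken in the abelian category of strict inverse
`S`-modules. -/
abbrev LauschCohomology {S : Type u} [Monoid S] [IsInverseSemigroup S] (A : LauschMod S)
    (n : ℕ) : Type (u + 1) :=
  Abelian.Ext.{u + 1} (LauschMod.trivialModule S) A n

/-! ### Partial group modules and partial group cohomology -/

section Ideals

variable {A : Type*} [CommMonoid A]

/-- The ideal `eA` of a commutative monoid `A` generated by `e`. -/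
def idealOf (e : A) : Subsemigroup A where
  carrier := {a | ∃ b, e * b = a}
  mul_mem' := by
    rintro _ _ ⟨b, rfl⟩ ⟨c, rfl⟩
    exact ⟨b * (e * c), by ac_rfl⟩

theorem mul_mem_idealOf (e a : A) : e * a ∈ idealOf e := ⟨a, rfl⟩

theorem mul_eq_of_mem_idealOf {e a : A} (he : IsIdempotentElem e) (ha : a ∈ idealOf e) :
    e * a = a := by
  obtain ⟨b, rfl⟩ := ha
  rw [← mul_assoc, he.eq]

/-- The ideal `eA` generated by an idempotent `e`, as a monoid with identity `e`. -/
def Corner (e : A) (_ : IsIdempotentElem e) : Type _ := idealOf e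

instance (e : A) (he : IsIdempotentElem e) : CommMonoid (Corner e he) where
  mul a b := ⟨a.1 * b.1, mul_mem a.2 b.2⟩
  one := ⟨e, 1, mul_one e⟩
  mul_assoc a b c := Subtype.ext (mul_assoc a.1 b.1 c.1)
  one_mul a := Subtype.ext (mul_eq_of_mem_idealOf he a.2)
  mul_one a := Subtype.ext ((mul_comm _ _).trans (mul_eq_of_mem_idealOf he a.2))
  mul_comm a b := Subtype.ext (mul_comm a.1 b.1)

/-- If `e' ≤ e`, multiplication by `e'` is a homomorphism of monoids `eA → e'A`. -/
def Corner.restrict {e e' : A} (he : IsIdempotentElem e) (he' : IsIdempotentElem e')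
    (h : e' * e = e') : Corner e he →* Corner e' he' where
  toFun a := ⟨e' * a.1, mul_mem_idealOf e' a.1⟩
  map_one' := Subtype.ext h
  map_mul' a b := Subtype.ext (by
    change e' * (a.1 * b.1) = e' * a.1 * (e' * b.1)
    calc e' * (a.1 * b.1) = (e' * e') * (a.1 * b.1) := by rw [he'.eq]
      _ = e' * a.1 * (e' * b.1) := by ac_rfl)

end Ideals

/-- A (unital) partial `G`-module structure on a commutative monoid `A`: a partial action `θ` of
the group `G` on `A` for which every ideal `A_x` is generated by an idempotent `1_x`. -/
structure PartialModule (G : Type*) [Group G] (A : Type*) [CommMonoid A] where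
  /-- The idempotent `1_x`; the ideal `A_x` is `idealOf (one x)`. -/
  one : G → A
  idem_one : ∀ x, IsIdempotentElem (one x)
  /-- The isomorphism `θ_x : A_{x⁻¹} → A_x`. -/
  theta : ∀ x, idealOf (one x⁻¹) ≃* idealOf (one x)
  /-- `A_1 = A`. -/
  ideal_one : idealOf (one 1) = ⊤
  /-- `θ_1 = id`. -/
  theta_one : ∀ a, (theta 1 a : A) = a
  /-- `θ_x(A_{x⁻¹} ∩ A_y) = A_x ∩ A_{xy}`. -/
  theta_image : ∀ x y, (fun a => (theta x a : A)) '' {a | (a : A) ∈ idealOf (one y)} =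
    (idealOf (one x) : Set A) ∩ idealOf (one (x * y))
  /-- `θ_x ∘ θ_y = θ_{xy}` on `A_{y⁻¹} ∩ A_{(xy)⁻¹}`; that `θ_y` maps this set to `A_{x⁻¹}` is
  part of the previous axiom. -/
  theta_theta : ∀ (x y : G) (a : A) (h₁ : a ∈ idealOf (one y⁻¹)) (h₂ : a ∈ idealOf (one (x * y)⁻¹))
    (h₃ : (theta y ⟨a, h₁⟩ : A) ∈ idealOf (one x⁻¹)),
    (theta x ⟨theta y ⟨a, h₁⟩, h₃⟩ : A) = theta (x * y) ⟨a, h₂⟩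

namespace PartialModule

variable {G : Type*} [Group G] {A : Type*} [CommMonoid A]

/-- A partial `G`-module is inverse if `A` is inverse and the idempotents of `A` are products of
elements `1_x`. -/
structure IsInverse (P : PartialModule G A) : Prop where
  isInverseSemigroup : IsInverseSemigroup A
  idem_mem_closure : ∀ a : A, IsIdempotentElem a → a ∈ Submonoid.closure (Set.range P.one)

variable (P : PartialModule G A)

/-- The endomorphism `a ↦ θ_x(1_{x⁻¹} a)` of the semigroup `A`. -/
def act (x : G) : A →ₙ* A where
  toFun a := P.theta x ⟨P.one x⁻¹ * a, mul_mem_idealOf _ _⟩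
  map_mul' a b := by
    rw [← MulMemClass.coe_mul, ← map_mul]
    congr 2
    apply Subtype.ext
    change P.one x⁻¹ * (a * b) = P.one x⁻¹ * a * (P.one x⁻¹ * b)
    calc P.one x⁻¹ * (a * b) = (P.one x⁻¹ * P.one x⁻¹) * (a * b) := by rw [(P.idem_one _).eq]
      _ = _ := by ac_rfl

theorem one_one : P.one 1 = 1 := by
  have h : (1 : A) ∈ idealOf (P.one 1) := by rw [P.ideal_one]; trivial
  rw [← mul_one (P.one 1), mul_eq_of_mem_idealOf (P.idem_one 1) h]

/-- `θ_x(1_{x⁻¹} 1_y) = 1_x 1_{xy}`. -/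
theorem act_one (x y : G) : P.act x (P.one y) = P.one x * P.one (x * y) := by
  have himg := P.theta_image x y
  -- both sides lie in the ideal and are identities there
  have h1 : P.act x (P.one y) ∈ (idealOf (P.one x) : Set A) ∩ idealOf (P.one (x * y)) := by
    rw [← himg]
    exact ⟨_, ⟨P.one x⁻¹, mul_comm _ _⟩, rfl⟩
  have h2 : P.one x * P.one (x * y) ∈
      (idealOf (P.one x) : Set A) ∩ idealOf (P.one (x * y)) := ⟨⟨_, rfl⟩, ⟨_, mul_comm _ _⟩⟩
  rw [← himg] at h2
  obtain ⟨a, ha, hb⟩ := h2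
  have ha' := mul_eq_of_mem_idealOf (P.idem_one y) ha
  have ha'' := mul_eq_of_mem_idealOf (P.idem_one _) a.2
  have h3 : P.act x a = P.one x * P.one (x * y) := by
    rw [← hb]
    change ((P.theta x _ : idealOf (P.one x)) : A) = P.theta x a
    congr 2
    exact Subtype.ext ha''
  calc P.act x (P.one y)
      = P.one x * (P.one (x * y) * P.act x (P.one y)) := by
        rw [mul_eq_of_mem_idealOf (P.idem_one _) h1.2, mul_eq_of_mem_idealOf (P.idem_one _) h1.1]
    _ = P.act x (P.one y) * P.act x a := by rw [h3]; ac_rfl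
    _ = P.one x * P.one (x * y) := by rw [← map_mul, ha', h3]

theorem one_mul_act (x : G) (a : A) : P.one x * P.act x a = P.act x a :=
  mul_eq_of_mem_idealOf (P.idem_one x) (P.theta x _).2

/-- The idempotent `e_n(x_1, …, x_n) = 1_{x_1} 1_{x_1 x_2} ⋯ 1_{x_1 ⋯ x_n}`. -/
def e {n : ℕ} (x : Fin n → G) : A := ∏ i : Fin n, P.one (Fin.partialProd x i.succ)

theorem idem_e {n : ℕ} (x : Fin n → G) : IsIdempotentElem (P.e x) := by
  unfold IsIdempotentElem e
  rw [← Finset.prod_mul_distrib]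
  exact Finset.prod_congr rfl fun i _ => P.idem_one _

theorem e_mul_one {n : ℕ} (x : Fin n → G) (i : Fin (n + 1)) :
    P.e x * P.one (Fin.partialProd x i) = P.e x := by
  refine Fin.cases ?_ (fun i => ?_) i
  · rw [Fin.partialProd_zero, one_one, mul_one]
  · have := Finset.mul_prod_erase Finset.univ (fun i => P.one (Fin.partialProd x (Fin.succ i)))
      (Finset.mem_univ i)
    unfold e
    rw [← this, mul_comm, ← mul_assoc, (P.idem_one _).eq]

theorem e_mul_e_contractNth {n : ℕ} (x : Fin (n + 1) → G) (j : Fin (n + 1)) :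
    P.e x * P.e (j.contractNth (· * ·) x) = P.e x := by
  have h : ∀ s : Finset (Fin n),
      P.e x * ∏ i ∈ s, P.one (Fin.partialProd (j.contractNth (· * ·) x) i.succ) = P.e x := by
    intro s
    induction s using Finset.induction_on with
    | empty => rw [Finset.prod_empty, mul_one]
    | insert i s hi ih =>
      rw [Finset.prod_insert hi, ← mul_assoc, Fin.partialProd_contractNth, Function.comp_apply,
        e_mul_one, ← Fin.partialProd_contractNth, ih]
  exact h Finset.univ

theorem act_e_tail {n : ℕ} (x : Fin (n + 1) → G) : P.act (x 0) (P.e (Fin.tail x)) = P.e x := by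
  have h : ∀ (m : ℕ) (z : G) (y : Fin m → G),
      P.act z (∏ i, P.one (y i)) = P.one z * ∏ i, P.one (z * y i) := by
    intro m z
    induction m with
    | zero =>
      intro y
      rw [Fin.prod_univ_zero, Fin.prod_univ_zero, ← P.one_one, act_one, mul_one, P.one_one,
        mul_one, (P.idem_one z).eq]
    | succ m ih =>
      intro y
      rw [Fin.prod_univ_succ, map_mul, act_one, ih, Fin.prod_univ_succ]
      calc _ = (P.one z * P.one z) * (P.one (z * y 0) * ∏ i : Fin m, P.one (z * y i.succ)) := by
            ac_rfl
        _ = _ := by rw [(P.idem_one z).eq]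
  unfold e
  rw [h, Fin.prod_univ_succ]
  congr 1
  · rw [Fin.partialProd_succ, Fin.castSucc_zero, Fin.partialProd_zero, one_mul]
  · refine Finset.prod_congr rfl fun i _ => ?_
    rw [Fin.partialProd_succ' x]

/-- `a ↦ θ_{x_1}(1_{x_1⁻¹} a)` as a homomorphism of monoids
`A_{(x_2, …, x_{n+1})} → A_{(x_1, …, x_{n+1})}`. -/
def actCorner {n : ℕ} (x : Fin (n + 1) → G) :
    Corner (P.e (Fin.tail x)) (P.idem_e _) →* Corner (P.e x) (P.idem_e x) where
  toFun a := ⟨P.act (x 0) a.1, P.act (x 0) a.1, by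
    rw [← act_e_tail, ← map_mul, mul_eq_of_mem_idealOf (P.idem_e _) a.2]⟩
  map_one' := Subtype.ext (P.act_e_tail x)
  map_mul' a b := Subtype.ext (map_mul (P.act (x 0)) a.1 b.1)

/-- The group `C^n(G, A)` of `n`-cochains, under pointwise multiplication: functions sending
`(x_1, …, x_n)` to an invertible element of the ideal `A_{(x_1, …, x_n)}`, the ideal generated by
`e_n(x_1, …, x_n)`. For `n = 0` these are the invertible elements of `A`. -/
abbrev Cochain (n : ℕ) : Type _ := ∀ x : Fin n → G, (Corner (P.e x) (P.idem_e x))ˣ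

/-- The coboundary homomorphism `δ^n : C^n(G, A) → C^{n+1}(G, A)`,
`(δ^n f)(x_1, …, x_{n+1}) = θ_{x_1}(1_{x_1⁻¹} f(x_2, …, x_{n+1}))`
`∏_{i=1}^n f(x_1, …, x_i x_{i+1}, …, x_{n+1})^{(-1)^i} · f(x_1, …, x_n)^{(-1)^{n+1}}`.
The factors are multiplied by the identity of `A_{(x_1, …, x_{n+1})}`, which does not change the
product since the first factor lies in this ideal, see `delta_apply`. The index `j : Fin (n + 1)` stands for
`i = j + 1`, and its last value for the last factor. -/
def delta (n : ℕ) : P.Cochain n →* P.Cochain (n + 1) where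
  toFun f x :=
    Units.map (P.actCorner x) (f (Fin.tail x)) *
      ∏ j : Fin (n + 1), Units.map (Corner.restrict (P.idem_e _) (P.idem_e x)
        (P.e_mul_e_contractNth x j)) (f (j.contractNth (· * ·) x)) ^ ((-1 : ℤ) ^ (j.1 + 1))
  map_one' := by
    funext x
    simp only [Pi.one_apply, map_one, one_zpow, Finset.prod_const_one, mul_one]
  map_mul' f g := by
    funext x
    simp only [Pi.mul_apply, map_mul, mul_zpow, Finset.prod_mul_distrib]
    exact mul_mul_mul_comm _ _ _ _

theorem val_mul_prod_restrict {e' : A} (he' : IsIdempotentElem e') {ι : Type*} (s : Finset ι)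
    (e : ι → A) (he : ∀ i, IsIdempotentElem (e i)) (h : ∀ i, e' * e i = e')
    (u : (Corner e' he')ˣ) (v : ∀ i, (Corner (e i) (he i))ˣ) :
    (u * ∏ i ∈ s, Units.map (Corner.restrict (he i) he' (h i)) (v i)).1.1 =
      u.1.1 * ∏ i ∈ s, (v i).1.1 := by
  classical
  induction s using Finset.induction_on generalizing u with
  | empty => rw [Finset.prod_empty, Finset.prod_empty, mul_one, mul_one]
  | insert i s hi ih =>
    rw [Finset.prod_insert hi, Finset.prod_insert hi, ← mul_assoc, ih, ← mul_assoc]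
    congr 1
    change u.1.1 * (e' * (v i).1.1) = u.1.1 * (v i).1.1
    rw [← mul_assoc, mul_comm u.1.1, mul_eq_of_mem_idealOf he' u.1.2]

/-- The defining formula of `δ^n`, as an identity in `A`. Here the inverse of a value of `f` is its
inverse in the corresponding ideal. -/
theorem delta_apply {n : ℕ} (f : P.Cochain n) (x : Fin (n + 1) → G) :
    (P.delta n f x).1.1 = P.act (x 0) (f (Fin.tail x)).1.1 *
      ∏ j : Fin (n + 1), (f (j.contractNth (· * ·) x) ^ ((-1 : ℤ) ^ (j.1 + 1))).1.1 := by
  have h := val_mul_prod_restrict (P.idem_e x) Finset.univ _ (fun _ => P.idem_e _)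
    (P.e_mul_e_contractNth x) (Units.map (P.actCorner x) (f (Fin.tail x)))
    (fun j => f (j.contractNth (· * ·) x) ^ ((-1 : ℤ) ^ (j.1 + 1)))
  simp only [map_zpow] at h
  exact h

/-- The cocycles `Z^n(G, A)`, the kernel of `δ^n`. -/
def cocycles (n : ℕ) : Subgroup (P.Cochain n) := (P.delta n).ker

/-- The coboundaries `B^n(G, A)`: the image of `δ^{n-1}` if `n ≥ 1`, trivial if `n = 0`. -/
def coboundaries : (n : ℕ) → Subgroup (P.Cochain n)
  | 0 => ⊥
  | n + 1 => (P.delta n).range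

/-- The partial cohomology group `H^n(G, A) = Z^n(G, A) / B^n(G, A)`; here
`B^n(G, A) ⊆ Z^n(G, A)` as `δ^{n+1} ∘ δ^n` is trivial. -/
abbrev Cohomology (n : ℕ) : Type _ :=
  P.cocycles n ⧸ (P.coboundaries n).subgroupOf (P.cocycles n)

end PartialModule

end PartialCohomology

open PartialCohomology

/-! For `x` in `G`, let `m_x` be the maximum element of the class `x` and `1_x = m_x m_x⁻¹`. Every
`s` equals `s s⁻¹ m_{[s]}` (`range_mul_maxElt`), so an `S`-action amounts to the maps `λ_{m_x}` cut
down by idempotents. The partial action is `θ_x = λ_{m_x}` on `α(1_{x⁻¹}) A`; its axioms rest on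
`m_x 1_y m_x⁻¹ = 1_x 1_{xy}` (`conj_maxElt_oneI`). When the `m_x` generate `S`, the same identity
shows that the `1_x` generate `E(S)`, which makes the partial module inverse.

`Ext` is computed from a homogeneous bar resolution of `ℤ_S`. A tuple `g` in `G^{n+1}` gets the
domain `∏ 1_{g_i}`, and `F_n` consists of pairs `(e, c)` with `c` an integral combination of tuples
whose domain is at least `e`.

Exactness is checked in each component. Over `e` the augmented complex is that of the full simplex
on `{x | e ≤ 1_x}`, a set containing `1` because `1_1 = 1`; prepending `1` contracts it
(`boundary_cone`). This homotopy is not equivariant, and need not be.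

Projectivity of `F_n` comes from a smaller generating set. As `dom g ≤ 1_{g_0}`, the tuple `g` is
the restriction to `dom g` of the `m_{g_0}`-translate of a tuple `(1, x_1, x_1 x_2, …)`
(`basis_eq_lam_gen`). A morphism `F_n → A` therefore amounts to a free choice, for every `(x_1, …,
x_n)`, of an element in the component of `1_{x_1} ⋯ 1_{x_1 ⋯ x_n}`. That component is the unit group
of the corresponding ideal of `A`, so `Hom(F_n, A) = C^n(G, A)` (`cochainEquiv`). On these
generators the simplicial faces give the terms of `δ^n` (`cochainEquiv_tuplesD_comp`). -/

namespace PartialCohomology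

/-! ### Projective resolutions from exact complexes -/

/-- A complex of projective objects which is exact in positive degrees, with an augmentation which
is a cokernel of the first differential, gives a projective resolution. -/
noncomputable def projectiveResolutionOfExact {C : Type*} [Category C] [Abelian C]
    {Z : C} (K : ChainComplex C ℕ) (hK : ∀ n, Projective (K.X n)) (ε : K.X 0 ⟶ Z)
    (w : K.d 1 0 ≫ ε = 0) (h₀ : (ShortComplex.mk _ _ w).Exact) (hε : Epi ε)
    (h : ∀ n, (ShortComplex.mk _ _ (K.d_comp_d (n + 2) (n + 1) n)).Exact) :
    ProjectiveResolution Z where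
  complex := K
  projective := hK
  π := (ChainComplex.toSingle₀Equiv _ _).symm ⟨ε, w⟩
  quasiIso := ⟨fun n => by
    cases n with
    | zero =>
      -- In degree `0` the quasi-isomorphism condition is exactness at `K.X 0` together with `ε`
      -- being an epimorphism.
      rw [ChainComplex.quasiIsoAt₀_iff, ShortComplex.quasiIso_iff_of_zeros' _ (K.shape _ _ (by simp)) rfl rfl]
      refine (ShortComplex.exact_and_epi_g_iff_of_iso ?_).2 ⟨h₀, hε⟩
      refine ShortComplex.isoMk (Iso.refl _) (Iso.refl _) (Iso.refl _) ?_ ?_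
      · exact (Category.id_comp _).trans (Category.comp_id _).symm
      · refine (Category.id_comp _).trans (Eq.trans ?_ (Category.comp_id _).symm)
        exact (ChainComplex.toSingle₀Equiv_symm_apply_f_zero ε w).symm
    | succ n =>
      -- In positive degrees the target has no homology, so the condition is exactness of `K`.
      rw [quasiIsoAt_iff_exactAt' _ _ (ChainComplex.exactAt_succ_single_obj _ _),
        HomologicalComplex.exactAt_iff' _ (n + 2) (n + 1) n (by simp) (by simp)]
      exact h n⟩

/-! ### Computing `Ext` from a projective resolution -/

section Ext

variable {C : Type*} [Category C] [Abelian C] [HasExt C] {X Y : C} (R : ProjectiveResolution X)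

open CochainComplex.HomComplex in
-- There are no coboundaries in degree `0`: viewed as a cochain complex, the resolution vanishes in
-- degree `1`, so the only candidate primitive is zero.
theorem extMk_zero_eq_zero_iff (f : R.complex.X 0 ⟶ Y) (hf : R.complex.d 1 0 ≫ f = 0) :
    R.extMk f 1 rfl hf = 0 ↔ f = 0 := by
  constructor
  · intro h
    rw [← R.extEquivCohomologyClass.apply_eq_iff_eq, R.extEquivCohomologyClass_extMk,
      R.extEquivCohomologyClass_zero, CohomologyClass.mk_eq_zero_iff,
      Cocycle.toSingleMk_mem_coboundaries_iff _ _ _ _ _ 1 (by simp)] at h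
    obtain ⟨g, hg⟩ := h
    have hg0 : g = 0 := (CochainComplex.isZero_of_isStrictlyLE R.cochainComplex 0 1).eq_of_src _ _
    rw [hg0, Limits.comp_zero] at hg
    rw [← cancel_epi (R.cochainComplexXIso (-(0 : ℕ)) 0 rfl).hom, Limits.comp_zero]
    exact hg.symm
  · rintro rfl
    exact R.extMk_zero 1 rfl

variable {C' : Type*} [CommGroup C'] {n : ℕ} (φ : (R.complex.X n ⟶ Y) ≃+ Additive C')
  (Z B : Subgroup C')

/-- If the morphisms from the `n`-th term of a projective resolution form a group `C'`, in which
`Z` corresponds to the cocycles and `B` to the coboundaries, then the `n`-th `Ext` group is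
`Z / B`. -/
theorem nonempty_ext_addEquiv (hZ : ∀ f, (φ f).toMul ∈ Z ↔ R.complex.d (n + 1) n ≫ f = 0)
    (hB : ∀ f (hf : R.complex.d (n + 1) n ≫ f = 0), (φ f).toMul ∈ B ↔ R.extMk f (n + 1) rfl hf = 0) :
    Nonempty (Abelian.Ext X Y n ≃+ Additive (Z ⧸ B.subgroupOf Z)) := by
  have hd (z : Z) : R.complex.d (n + 1) n ≫ φ.symm (Additive.ofMul z.1) = 0 := by
    rw [← hZ, AddEquiv.apply_symm_apply]
    exact z.2
  let Φ : Z →* Multiplicative (Abelian.Ext X Y n) :=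
    MonoidHom.mk' (fun z => Multiplicative.ofAdd (R.extMk _ (n + 1) rfl (hd z))) fun z w => by
      rw [← ofAdd_add, R.add_extMk]
      congr 2
      exact map_add φ.symm (Additive.ofMul z.1) (Additive.ofMul w.1)
  -- Every class in `Ext` is represented by a cocycle on the resolution; with the kernel found next,
  -- the first isomorphism theorem concludes.
  have hΦ : Function.Surjective Φ := fun e => by
    obtain ⟨f, hf, h⟩ := R.extMk_surjective e.toAdd (n + 1) rfl
    refine ⟨⟨(φ f).toMul, (hZ f).2 hf⟩, ?_⟩
    change Multiplicative.ofAdd (R.extMk (φ.symm (φ f)) _ _ _) = Multiplicative.ofAdd e.toAdd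
    simp only [AddEquiv.symm_apply_apply, h]
  have hker : Φ.ker = B.subgroupOf Z := by
    ext z
    rw [MonoidHom.mem_ker, Subgroup.mem_subgroupOf]
    have h := hB _ (hd z)
    rw [AddEquiv.apply_symm_apply] at h
    exact h.symm
  let e := (QuotientGroup.quotientMulEquivOfEq hker).symm.trans
    (QuotientGroup.quotientKerEquivOfSurjective Φ hΦ)
  exact ⟨(MulEquiv.toAdditiveLeft e).symm⟩

end Ext

/-! ### `F`-inverse monoids -/

namespace Idem

variable {S : Type*} [Monoid S] [IsInverseSemigroup S]

/-- The idempotent `s s⁻¹`. -/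
noncomputable def range (s : S) : Idem S := ⟨s * sinv s, idem_mul_sinv s⟩

theorem range_mul_self (s : S) : (range s).1 * s = s := mul_sinv_mul s

theorem range_mul (s t : S) : range (s * t) = conj s (range t) := by
  apply Subtype.ext
  simp only [range, conj, sinv_mul, mul_assoc]

theorem range_idem (e : Idem S) : range e.1 = e :=
  Subtype.ext (by simp only [range]; rw [sinv_idem e.2, e.2.eq])

theorem conj_range_mul (s : S) (e : Idem S) : range s * conj s e = conj s e := by
  apply Subtype.ext
  change s * sinv s * (s * e.1 * sinv s) = s * e.1 * sinv s
  rw [← mul_assoc, ← mul_assoc, mul_sinv_mul]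

theorem conj_le_conj (s : S) {e f : Idem S} (h : e * f = e) :
    conj s e * conj s f = conj s e := by
  rw [← conj_mul, h]

theorem conj_conj_sinv (s : S) (e : Idem S) : conj s (conj (sinv s) e) = range s * e := by
  rw [← conj_conj, show s * sinv s = (range s).1 from rfl, conj_idem]

/-- The order `e ≤ f` on idempotents is written `e * f = e` throughout. -/
theorem le_trans {e f g : Idem S} (h : e * f = e) (h' : f * g = f) : e * g = e := by
  rw [← h, mul_assoc, h']

/-- In the semilattice of idempotents a product is a meet. -/
theorem le_prod_iff {ι : Type*} (s : Finset ι) (f : ι → Idem S) (e : Idem S) :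
    e * ∏ i ∈ s, f i = e ↔ ∀ i ∈ s, e * f i = e := by
  classical
  induction s using Finset.induction_on with
  | empty => simp
  | insert i s hi ih =>
    rw [Finset.prod_insert hi, Finset.forall_mem_insert, ← ih]
    constructor
    · intro h
      constructor
      · rw [← h]
        calc _ = e * (f i * f i) * ∏ i ∈ s, f i := by ac_rfl
          _ = _ := by rw [mul_self, mul_assoc]
      · rw [← h]
        calc _ = e * f i * ((∏ i ∈ s, f i) * (∏ i ∈ s, f i)) := by ac_rfl
          _ = _ := by rw [mul_self, mul_assoc]
    · rintro ⟨h, h'⟩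
      rw [← mul_assoc, h, h']

end Idem

/-! ### Maximum elements of the `σ`-classes -/

section MaxElement

variable {S : Type*} [Monoid S] [IsInverseSemigroup S]

/-- The class of `s` in the maximum group image, as a homomorphism. -/
def toGroup (S : Type*) [Monoid S] [IsInverseSemigroup S] : S →* MaxGroupImage S := (sigma S).mk'

theorem toGroup_eq_iff {s t : S} : toGroup S s = toGroup S t ↔ sigma S s t := Con.eq _

theorem toGroup_idem {e : S} (he : IsIdempotentElem e) : toGroup S e = 1 :=
  toGroup_eq_iff.2 (sigma_idem he)

theorem toGroup_sinv (s : S) : toGroup S (sinv s) = (toGroup S s)⁻¹ := by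
  rw [eq_inv_iff_mul_eq_one, ← map_mul, toGroup_idem (idem_sinv_mul s)]

theorem exists_toGroup_isSigmaMax (hF : IsFInverse S) (x : MaxGroupImage S) :
    ∃ m : S, toGroup S m = x ∧ IsSigmaMax m := by
  induction x using Con.induction_on with
  | H s =>
    obtain ⟨m, ⟨h, h'⟩, -⟩ := hF s
    exact ⟨m, toGroup_eq_iff.2 h, h'⟩

/-- The maximum element of the `σ`-class `x`. -/
noncomputable def maxElt (hF : IsFInverse S) (x : MaxGroupImage S) : S :=
  (exists_toGroup_isSigmaMax hF x).choose

variable (hF : IsFInverse S)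

theorem toGroup_maxElt (x : MaxGroupImage S) : toGroup S (maxElt hF x) = x :=
  (exists_toGroup_isSigmaMax hF x).choose_spec.1

theorem isSigmaMax_maxElt (x : MaxGroupImage S) : IsSigmaMax (maxElt hF x) :=
  (exists_toGroup_isSigmaMax hF x).choose_spec.2

theorem eq_maxElt {m : S} (hm : IsSigmaMax m) : m = maxElt hF (toGroup S m) :=
  (hF m).unique ⟨(sigma S).refl m, hm⟩
    ⟨toGroup_eq_iff.1 (toGroup_maxElt hF _), isSigmaMax_maxElt hF _⟩

/-- Maximality gives `s = e m` for some idempotent `e`; then `s s⁻¹ = e m m⁻¹` serves equally well.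
Thus `s` is recovered from its class and `s s⁻¹`. -/
theorem range_mul_maxElt (s : S) : (Idem.range s).1 * maxElt hF (toGroup S s) = s := by
  obtain ⟨e, he, h⟩ := isSigmaMax_maxElt hF (toGroup S s) s
    (toGroup_eq_iff.1 (toGroup_maxElt hF _).symm)
  generalize maxElt hF (toGroup S s) = m at h
  have hc := idem_comm he (idem_mul_sinv m)
  subst h
  change e * m * sinv (e * m) * m = e * m
  rw [sinv_mul, sinv_idem he]
  calc e * m * (sinv m * e) * m = e * ((m * sinv m) * e) * m := by simp only [mul_assoc]
    _ = (e * e) * (m * sinv m * m) := by rw [← hc]; simp only [mul_assoc]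
    _ = e * m := by rw [he.eq, mul_sinv_mul]

theorem maxElt_one : maxElt hF 1 = 1 := by
  have h := range_mul_maxElt hF (1 : S)
  rwa [show (1 : S) = (1 : Idem S).1 from rfl, Idem.range_idem, Idem.val_one, map_one,
    one_mul] at h

/-- Inversion preserves the natural order: `t⁻¹ = e m` gives `t = m⁻¹ e = (m⁻¹ e m) m⁻¹`. -/
theorem isSigmaMax_sinv {m : S} (hm : IsSigmaMax m) : IsSigmaMax (sinv m) := by
  intro t ht
  have h : toGroup S (sinv t) = toGroup S m := by
    rw [toGroup_sinv, toGroup_eq_iff.2 ht, toGroup_sinv, inv_inv]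
  obtain ⟨e, he, h⟩ := hm _ (toGroup_eq_iff.1 h)
  have ht : t = sinv m * e := by rw [← sinv_sinv t, h, sinv_mul, sinv_idem he]
  refine ⟨sinv m * e * sinv (sinv m), idem_conj _ he, ?_⟩
  rw [sinv_sinv, ht]
  calc sinv m * e = sinv m * m * sinv m * e := by rw [sinv_mul_sinv]
    _ = sinv m * ((m * sinv m) * e) := by simp only [mul_assoc]
    _ = _ := by rw [idem_comm (idem_mul_sinv m) he]; simp only [mul_assoc]

theorem maxElt_inv (x : MaxGroupImage S) : maxElt hF x⁻¹ = sinv (maxElt hF x) := by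
  rw [eq_maxElt hF (isSigmaMax_sinv (isSigmaMax_maxElt hF x)), toGroup_sinv, toGroup_maxElt]

/-- The idempotent `m m⁻¹`, where `m` is the maximum element of the class `x`. -/
noncomputable def oneI (x : MaxGroupImage S) : Idem S := Idem.range (maxElt hF x)

theorem oneI_one : oneI hF 1 = 1 := by
  rw [oneI, maxElt_one, show (1 : S) = (1 : Idem S).1 from rfl, Idem.range_idem]

theorem range_mul_oneI (s : S) :
    Idem.range s * oneI hF (toGroup S s) = Idem.range s := by
  have h := congrArg Idem.range (range_mul_maxElt hF s)
  rwa [Idem.range_mul, Idem.conj_idem] at h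

/-- `s 1_y s⁻¹ ≤ 1_{[s] y}`. -/
theorem conj_oneI_mul (s : S) (y : MaxGroupImage S) :
    Idem.conj s (oneI hF y) * oneI hF (toGroup S s * y) = Idem.conj s (oneI hF y) := by
  have h := range_mul_oneI hF (s * maxElt hF y)
  rwa [Idem.range_mul, map_mul, toGroup_maxElt] at h

/-- The inequality `≤` is `conj_oneI_mul`. For `≥`, the same bound for `m_{x⁻¹}` puts `m_x⁻¹ p m_x`
below `1_y`, where `p` is the right-hand side; conjugating back by `m_x` returns `1_x p = p`. -/
theorem conj_maxElt_oneI (x y : MaxGroupImage S) :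
    Idem.conj (maxElt hF x) (oneI hF y) = oneI hF x * oneI hF (x * y) := by
  set p := oneI hF x * oneI hF (x * y)
  have hx : oneI hF x * p = p := by rw [← mul_assoc, Idem.mul_self]
  have h1 : Idem.conj (maxElt hF x) (oneI hF y) * p = Idem.conj (maxElt hF x) (oneI hF y) := by
    have h := conj_oneI_mul hF (maxElt hF x) y
    rw [toGroup_maxElt] at h
    rw [← mul_assoc, mul_comm _ (oneI hF x), show oneI hF x * _ = _ from Idem.conj_range_mul _ _, h]
  have h2 : Idem.conj (maxElt hF x⁻¹) p * oneI hF y = Idem.conj (maxElt hF x⁻¹) p := by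
    have h := conj_oneI_mul hF (maxElt hF x⁻¹) (x * y)
    rw [toGroup_maxElt, inv_mul_cancel_left] at h
    rw [Idem.conj_mul, mul_assoc, h]
  have h3 := Idem.conj_le_conj (maxElt hF x) h2
  rw [maxElt_inv, Idem.conj_conj_sinv, show Idem.range (maxElt hF x) * p = p from hx] at h3
  rw [← h1, mul_comm, h3]

end MaxElement

/-! ### The partial module attached to a module over an `F`-inverse monoid -/

namespace SModule

variable {S : Type*} [Monoid S] [IsInverseSemigroup S] {A : Type*} [CommMonoid A]
  (M : SModule S A) (hF : IsFInverse S)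

/-- The action of `s` is the action of the maximum element of its class, restricted to the component
of `s s⁻¹`. -/
theorem lam_eq_maxElt (s : S) (a : A) :
    M.lam s a = M.alpha (Idem.range s) * M.lam (maxElt hF (toGroup S s)) a := by
  rw [← M.lam_idem, ← M.lam_mul, range_mul_maxElt]

theorem lam_lam_maxElt (s : S) (y : MaxGroupImage S) (a : A) :
    M.lam s (M.lam (maxElt hF y) a) =
      M.alpha (Idem.conj s (oneI hF y)) * M.lam (maxElt hF (toGroup S s * y)) a := by
  rw [← M.lam_mul, M.lam_eq_maxElt hF, Idem.range_mul, map_mul, toGroup_maxElt, oneI]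

theorem alpha_mul_mem {e : Idem S} {a : A} (h : a ∈ idealOf (M.alpha e)) : M.alpha e * a = a :=
  mul_eq_of_mem_idealOf (M.idem_alpha e) h

theorem lam_maxElt_mem (x : MaxGroupImage S) (a : A) :
    M.lam (maxElt hF x) a ∈ idealOf (M.alpha (oneI hF x)) := by
  refine ⟨M.lam (maxElt hF x) a, ?_⟩
  rw [← M.lam_idem, ← M.lam_mul, oneI, Idem.range_mul_self]

theorem lam_maxElt_inv {x y : MaxGroupImage S} (hxy : x * y = 1) {a : A}
    (ha : a ∈ idealOf (M.alpha (oneI hF x))) :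
    M.lam (maxElt hF x) (M.lam (maxElt hF y) a) = a := by
  rw [lam_lam_maxElt, toGroup_maxElt, conj_maxElt_oneI, hxy, maxElt_one, M.lam_one, oneI_one,
    mul_one, M.alpha_mul_mem ha]

theorem lam_maxElt_mem_of_mem {x y : MaxGroupImage S} {a : A}
    (ha : a ∈ idealOf (M.alpha (oneI hF y))) :
    M.lam (maxElt hF x) a ∈ idealOf (M.alpha (oneI hF (x * y))) := by
  refine ⟨M.lam (maxElt hF x) a, ?_⟩
  nth_rw 2 [← M.alpha_mul_mem ha]
  rw [map_mul, M.lam_alpha, conj_maxElt_oneI, map_mul, mul_comm (M.alpha (oneI hF x)), mul_assoc,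
    M.alpha_mul_mem (M.lam_maxElt_mem hF x a)]

/-- The partial module over the maximum group image given by a module over an `F`-inverse monoid:
the action of `x` is the restriction of the action of the maximum element of the class `x`. -/
noncomputable def partialModule : PartialModule (MaxGroupImage S) A where
  one x := M.alpha (oneI hF x)
  idem_one x := M.idem_alpha _
  theta x :=
    { toFun := fun a => ⟨M.lam (maxElt hF x) a, M.lam_maxElt_mem hF x a⟩
      invFun := fun a => ⟨M.lam (maxElt hF x⁻¹) a, M.lam_maxElt_mem hF x⁻¹ a⟩
      left_inv := fun a => Subtype.ext (M.lam_maxElt_inv hF (inv_mul_cancel x) a.2)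
      right_inv := fun a => Subtype.ext (M.lam_maxElt_inv hF (mul_inv_cancel x) a.2)
      map_mul' := fun a b => Subtype.ext (map_mul _ _ _) }
  ideal_one := by
    rw [oneI_one, map_one]
    exact eq_top_iff.2 fun a _ => ⟨a, one_mul a⟩
  theta_one a := by
    change M.lam (maxElt hF 1) a = a
    rw [maxElt_one, M.lam_one]
  theta_image x y := by
    ext b
    constructor
    · rintro ⟨a, ha, rfl⟩
      exact ⟨M.lam_maxElt_mem hF x _, M.lam_maxElt_mem_of_mem hF ha⟩
    · rintro ⟨h1, h2⟩
      -- The preimage is `θ_{x⁻¹}(b)`; since `b` lies in `A_{xy}`, it lies in `A_{x⁻¹xy} = A_y`.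
      refine ⟨⟨M.lam (maxElt hF x⁻¹) b, M.lam_maxElt_mem hF x⁻¹ b⟩, ?_,
        M.lam_maxElt_inv hF (mul_inv_cancel x) h1⟩
      have := M.lam_maxElt_mem_of_mem hF (x := x⁻¹) h2
      rwa [inv_mul_cancel_left] at this
  theta_theta x y a h₁ h₂ h₃ := by
    change M.lam (maxElt hF x) (M.lam (maxElt hF y) a) = M.lam (maxElt hF (x * y)) a
    -- The composite `λ_{m_x} λ_{m_y}` differs from `λ_{m_{xy}}` by the factor `α(1_x 1_{xy})`. Its
    -- part `1_{xy}` is absorbed in any case, and `1_x` because `a` in `A_{y⁻¹}` is sent into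
    -- `A_{xyy⁻¹} = A_x`.
    have h := M.lam_maxElt_mem_of_mem hF (x := x * y) h₁
    rw [mul_inv_cancel_right] at h
    rw [lam_lam_maxElt, toGroup_maxElt, conj_maxElt_oneI, map_mul, mul_assoc,
      M.alpha_mul_mem (M.lam_maxElt_mem hF (x * y) a), M.alpha_mul_mem h]

/-- Cutting down by `1_{x⁻¹}` beforehand changes nothing, as `m_x 1_{x⁻¹} m_x⁻¹ = 1_x`. -/
theorem partialModule_act (x : MaxGroupImage S) (a : A) :
    (M.partialModule hF).act x a = M.lam (maxElt hF x) a := by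
  change M.lam (maxElt hF x) (M.alpha (oneI hF x⁻¹) * a) = _
  rw [map_mul, M.lam_alpha, conj_maxElt_oneI, mul_inv_cancel, oneI_one, mul_one,
    M.alpha_mul_mem (M.lam_maxElt_mem hF x a)]

/-- If `S` is generated by the maximum elements, then every idempotent `s s⁻¹` is a product of
idempotents `1_x`. -/
theorem range_mem_closure (hgen : IsMaxGenerated S) (s : S) :
    Idem.range s ∈ Submonoid.closure (Set.range (oneI hF)) := by
  have hs : s ∈ Submonoid.closure {m : S | IsSigmaMax m} := by rw [hgen]; trivial
  induction hs using Submonoid.closure_induction_left with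
  | one =>
    rw [show (1 : S) = (1 : Idem S).1 from rfl, Idem.range_idem]
    exact one_mem _
  | mul_left m hm s _ ih =>
    -- As `(ms)(ms)⁻¹ = m (s s⁻¹) m⁻¹`, it remains to see that conjugation by `m_x` preserves
    -- products of the `1_y`; it sends `1_y` to `1_x 1_{xy}`.
    rw [Idem.range_mul, eq_maxElt hF hm]
    generalize toGroup S m = x
    generalize Idem.range s = e at ih
    rw [← Idem.conj_range_mul]
    induction ih using Submonoid.closure_induction_left with
    | one =>
      rw [← oneI_one hF, conj_maxElt_oneI, mul_one, oneI, Idem.mul_self, Idem.mul_self]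
      exact Submonoid.subset_closure ⟨x, rfl⟩
    | mul_left f hf e _ ih =>
      obtain ⟨y, rfl⟩ := hf
      rw [Idem.conj_mul, conj_maxElt_oneI, mul_left_comm]
      refine mul_mem (mul_mem ?_ ?_) ih <;> exact Submonoid.subset_closure ⟨_, rfl⟩

theorem partialModule_isInverse [IsInverseSemigroup A] (hM : M.IsStrict)
    (hgen : IsMaxGenerated S) : (M.partialModule hF).IsInverse where
  isInverseSemigroup := inferInstance
  idem_mem_closure a ha := by
    obtain ⟨e, rfl⟩ := hM.exists_alpha_eq a ha
    have h := Submonoid.mem_map_of_mem M.alpha (range_mem_closure hF hgen e.1)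
    rw [Idem.range_idem, MonoidHom.map_mclosure, ← Set.range_comp] at h
    exact h

end SModule

variable {S : Type u} [Monoid S] [IsInverseSemigroup S]

namespace LauschMod

/-! ### The components of a strict inverse module -/

/-- The component `A_e`, written additively. -/
@[ext]
structure Comp (A : LauschMod S) (e : Idem S) : Type u where
  val : A
  supp_val : supp val = e

noncomputable instance (A : LauschMod S) (e : Idem S) : Add (Comp A e) :=
  ⟨fun a b => ⟨a.1 * b.1, by rw [supp_mul, a.2, b.2, Idem.mul_self]⟩⟩

noncomputable instance (A : LauschMod S) (e : Idem S) : Zero (Comp A e) :=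
  ⟨⟨A.alpha e, supp_alpha e⟩⟩

noncomputable instance (A : LauschMod S) (e : Idem S) : Neg (Comp A e) :=
  ⟨fun a => ⟨sinv a.1, (supp_sinv _).trans a.2⟩⟩

noncomputable instance (A : LauschMod S) (e : Idem S) : AddCommGroup (Comp A e) where
  add_assoc a b c := Comp.ext (mul_assoc _ _ _)
  zero_add a := Comp.ext (alpha_mul_eq a.2)
  add_zero a := Comp.ext ((mul_comm _ _).trans (alpha_mul_eq a.2))
  add_comm a b := Comp.ext (mul_comm _ _)
  neg_add_cancel a := Comp.ext (by
    change sinv a.1 * a.1 = A.alpha e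
    rw [mul_comm, ← alpha_supp, a.2])
  nsmul := nsmulRec
  zsmul := zsmulRec

namespace Comp

variable {A B : LauschMod S} {e e' : Idem S}

theorem val_add (a b : Comp A e) : (a + b).1 = a.1 * b.1 := rfl

/-- The homomorphism of components given by a homomorphism of semigroups. -/
noncomputable def map (φ : A →ₙ* B) (h : ∀ a, supp a = e → supp (φ a) = e') :
    Comp A e →+ Comp B e' :=
  AddMonoidHom.mk' (fun a => ⟨φ a.1, h _ a.2⟩) fun a b => Comp.ext (map_mul φ a.1 b.1)

theorem val_map (φ : A →ₙ* B) (h : ∀ a, supp a = e → supp (φ a) = e') (a : Comp A e) :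
    (map φ h a).1 = φ a.1 := rfl

end Comp

end LauschMod

open LauschMod

/-! ### Free modules -/

/-- A set with an action of `S` on which the idempotents act trivially, together with an idempotent
`dom x` for each element `x` such that `s (dom x) s⁻¹ ≤ dom (s x)`. -/
structure DomSet (S : Type u) [Monoid S] [IsInverseSemigroup S] where
  carrier : Type u
  act : S → carrier → carrier
  act_idem : ∀ (e : Idem S) x, act e.1 x = x
  act_mul : ∀ s t x, act (s * t) x = act s (act t x)
  dom : carrier → Idem S
  conj_dom_mul : ∀ s x, Idem.conj s (dom x) * dom (act s x) = Idem.conj s (dom x)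

namespace DomSet

variable (X Y : DomSet S)

theorem le_dom_act (s : S) {e : Idem S} {x : X.carrier} (h : e * X.dom x = e) :
    Idem.conj s e * X.dom (X.act s x) = Idem.conj s e :=
  Idem.le_trans (Idem.conj_le_conj s h) (X.conj_dom_mul s x)

/-- The integral combinations of elements of `X` whose domain contains `e`. -/
noncomputable def supported (e : Idem S) : AddSubgroup (X.carrier →₀ ℤ) :=
  (Finsupp.supported ℤ ℤ {x | e * X.dom x = e}).toAddSubgroup

variable {X}

theorem supported_mono {e f : Idem S} (h : e * f = e) {c : X.carrier →₀ ℤ}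
    (hc : c ∈ X.supported f) : c ∈ X.supported e :=
  fun _ hx => Idem.le_trans h (hc hx)

theorem mapDomain_mem_supported {e e' : Idem S} {t : X.carrier → Y.carrier}
    (h : ∀ x, e * X.dom x = e → e' * Y.dom (t x) = e') {c : X.carrier →₀ ℤ}
    (hc : c ∈ X.supported e) : c.mapDomain t ∈ Y.supported e' := by
  classical
  intro y hy
  obtain ⟨x, hx, rfl⟩ := Finset.mem_image.1 (Finsupp.mapDomain_support hy)
  exact h x (hc hx)

theorem single_mem_supported {e : Idem S} {x : X.carrier} (h : e * X.dom x = e) (n : ℤ) :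
    Finsupp.single x n ∈ X.supported e := by
  classical
  intro y hy
  rw [Finset.mem_singleton.1 (Finsupp.support_single_subset hy)]
  exact h

variable (X)

/-- The pairs `(e, c)` where `c` is an integral combination of elements whose domain contains
`e`. -/
@[ext]
structure Elt where
  idx : Idem S
  coeff : X.carrier →₀ ℤ
  mem : coeff ∈ X.supported idx

variable {X}

theorem add_mem_supported {e f : Idem S} {c d : X.carrier →₀ ℤ} (hc : c ∈ X.supported e)
    (hd : d ∈ X.supported f) : c + d ∈ X.supported (e * f) :=
  add_mem (supported_mono (by rw [mul_right_comm, Idem.mul_self]) hc)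
    (supported_mono (by rw [mul_assoc, Idem.mul_self]) hd)

/-- A semilattice of abelian groups: the groups `supported e` grow as `e` decreases, and a product
is formed by including both factors in the group over `e f` and adding there. -/
noncomputable instance : CommMonoid X.Elt where
  mul p q := ⟨p.idx * q.idx, p.coeff + q.coeff, add_mem_supported p.mem q.mem⟩
  one := ⟨1, 0, zero_mem _⟩
  mul_assoc p q r := Elt.ext (mul_assoc _ _ _) (add_assoc _ _ _)
  one_mul p := Elt.ext (one_mul _) (zero_add _)
  mul_one p := Elt.ext (mul_one _) (add_zero _)
  mul_comm p q := Elt.ext (mul_comm _ _) (add_comm _ _)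

variable (X)

/-- The strict inverse module freely generated by the elements `x` in the components `dom x`,
subject to the relations `λ_s(x) = s (dom x) s⁻¹ · s x`. -/
noncomputable def free : LauschMod S where
  carrier := X.Elt
  isInverse := isInverseSemigroup_of_regular fun p => ⟨⟨p.idx, -p.coeff, neg_mem p.mem⟩,
    Elt.ext (by
      change p.idx * p.idx * p.idx = p.idx
      rw [Idem.mul_self, Idem.mul_self]) (by
      change p.coeff + -p.coeff + p.coeff = p.coeff
      rw [add_neg_cancel, zero_add])⟩
  str :=
    { lam := fun s => ⟨fun p => ⟨Idem.conj s p.idx, p.coeff.mapDomain (X.act s),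
          mapDomain_mem_supported X (fun _ => X.le_dom_act s) p.mem⟩,
        fun p q => Elt.ext (Idem.conj_mul s _ _) Finsupp.mapDomain_add⟩
      lam_one := fun p => Elt.ext (Idem.conj_one_left _) (by
        change p.coeff.mapDomain (X.act 1) = _
        rw [show X.act 1 = id from funext (X.act_idem 1), Finsupp.mapDomain_id])
      lam_mul := fun s t p => Elt.ext (Idem.conj_conj s t _) (by
        change p.coeff.mapDomain (X.act (s * t)) =
          (p.coeff.mapDomain (X.act t)).mapDomain (X.act s)
        rw [← Finsupp.mapDomain_comp, show X.act (s * t) = X.act s ∘ X.act t from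
          funext (X.act_mul s t)])
      alpha := ⟨⟨fun e => ⟨e, 0, zero_mem _⟩, rfl⟩, fun e f => Elt.ext rfl (add_zero 0).symm⟩
      lam_idem := fun e p => Elt.ext (Idem.conj_idem e _) (by
        change p.coeff.mapDomain (X.act e.1) = 0 + p.coeff
        rw [show X.act e.1 = id from funext (X.act_idem e), Finsupp.mapDomain_id, zero_add])
      lam_alpha := fun s e => Elt.ext rfl (Finsupp.mapDomain_zero (f := X.act s)) }
  strict :=
    { injective := fun e f h => by
        exact (Elt.ext_iff.1 h).1
      exists_alpha_eq := fun p hp => by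
        exact ⟨p.idx, Elt.ext rfl (add_eq_left.1 (Elt.ext_iff.1 hp).2).symm⟩ }

variable {X Y}

/-- The element `(e, c)` of a free module. -/
abbrev elt (e : Idem S) (c : X.carrier →₀ ℤ) (hc : c ∈ X.supported e) : X.free :=
  (⟨e, c, hc⟩ : X.Elt)

theorem alpha_free (e : Idem S) : X.free.alpha e = elt e 0 (zero_mem _) := rfl

theorem lam_elt (s : S) {e : Idem S} {c : X.carrier →₀ ℤ} (hc : c ∈ X.supported e) :
    X.free.lam s (elt e c hc) = elt (Idem.conj s e) (c.mapDomain (X.act s))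
      (mapDomain_mem_supported X (fun _ => X.le_dom_act s) hc) := rfl

theorem alpha_mul_elt (f : Idem S) {e : Idem S} {c : X.carrier →₀ ℤ} (hc : c ∈ X.supported e) :
    X.free.alpha f * elt e c hc =
      elt (f * e) c (supported_mono (by rw [mul_assoc, Idem.mul_self]) hc) :=
  Elt.ext rfl (zero_add c)

theorem sinv_elt {e : Idem S} {c : X.carrier →₀ ℤ} (hc : c ∈ X.supported e) :
    sinv (elt e c hc) = elt e (-c) (neg_mem hc) := by
  refine (eq_sinv ?_ ?_).symm
  · exact Elt.ext ((congrArg (· * e) (Idem.mul_self e)).trans (Idem.mul_self e))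
      (by change c + -c + c = c; rw [add_neg_cancel, zero_add])
  · exact Elt.ext ((congrArg (· * e) (Idem.mul_self e)).trans (Idem.mul_self e))
      (by change -c + c + -c = -c; rw [neg_add_cancel, zero_add])

theorem supp_elt {e : Idem S} {c : X.carrier →₀ ℤ} (hc : c ∈ X.supported e) :
    supp (elt e c hc) = e := by
  apply supp_eq
  rw [sinv_elt]
  exact Elt.ext (Idem.mul_self e).symm (add_neg_cancel c).symm

theorem induction_free {motive : X.free → Prop}
    (h : ∀ e c (hc : c ∈ X.supported e), motive (elt e c hc)) (p : X.free) : motive p :=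
  h (Elt.idx p) (Elt.coeff p) (Elt.mem p)

/-- The generator of a free module given by an element of `X`. -/
noncomputable def basis (x : X.carrier) : X.free :=
  elt (X.dom x) (Finsupp.single x 1) (single_mem_supported (Idem.mul_self _) 1)

theorem supp_basis (x : X.carrier) : supp (basis x) = X.dom x := supp_elt _

theorem lam_basis (s : S) (x : X.carrier) :
    X.free.lam s (basis x) = X.free.alpha (Idem.conj s (X.dom x)) * basis (X.act s x) := by
  rw [basis, lam_elt, basis, alpha_mul_elt]
  refine Elt.ext (X.conj_dom_mul s x).symm ?_
  exact Finsupp.mapDomain_single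

/-- Reduces statements about supported combinations to single elements `x` with `e ≤ dom x` by
induction on the subgroup generated. -/
theorem supported_eq_closure (e : Idem S) : X.supported e =
    AddSubgroup.closure ((fun x => Finsupp.single x 1) '' {x | e * X.dom x = e}) := by
  rw [supported, Finsupp.supported_eq_span_single, Submodule.span_int_eq_addSubgroupClosure]

/-- A morphism from a free module is determined by the images of the generators. -/
theorem free_hom_ext {A : LauschMod S} {f g : X.free ⟶ A} (h : ∀ x, f (basis x) = g (basis x)) :
    f = g := by
  ext p
  induction p using induction_free with
  | h e c hc =>
    have hc' := hc
    rw [supported_eq_closure] at hc'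
    revert hc
    induction hc' using AddSubgroup.closure_induction with
    | mem c hx =>
      obtain ⟨x, hx, rfl⟩ := hx
      intro hc
      have : elt e (Finsupp.single x 1) hc = X.free.alpha e * basis x := by
        rw [basis, alpha_mul_elt]
        exact Elt.ext hx.symm rfl
      rw [this, hom_mul, hom_mul, h, hom_alpha, hom_alpha]
    | zero =>
      intro hc
      rw [← alpha_free, hom_alpha, hom_alpha]
    | add c d hc hd ihc ihd =>
      rw [← supported_eq_closure] at hc hd
      intro _
      have : ∀ h, elt e (c + d) h = elt e c hc * elt e d hd := fun _ =>
        Elt.ext (Idem.mul_self e).symm rfl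
      rw [this, hom_mul, hom_mul, ihc, ihd]
    | neg c hc ih =>
      rw [← supported_eq_closure] at hc
      intro _
      rw [← sinv_elt hc, hom_sinv, hom_sinv, ih]

/-- The morphism of free modules given by a map of sets compatible with the actions and
domains. -/
noncomputable def freeMap (t : X.carrier → Y.carrier) (hs : ∀ s x, t (X.act s x) = Y.act s (t x))
    (hd : ∀ x, X.dom x * Y.dom (t x) = X.dom x) : X.free ⟶ Y.free :=
  (⟨⟨fun p => (⟨Elt.idx p, Finsupp.mapDomain t (Elt.coeff p),
        mapDomain_mem_supported Y (fun x h => Idem.le_trans h (hd x)) (Elt.mem p)⟩ : Y.Elt),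
      fun _ _ => Elt.ext rfl Finsupp.mapDomain_add⟩,
    fun _ => Elt.ext rfl (Finsupp.mapDomain_zero (f := t)),
    fun s p => Elt.ext rfl (by
      change ((Elt.coeff p).mapDomain (X.act s)).mapDomain t =
        ((Elt.coeff p).mapDomain t).mapDomain (Y.act s)
      rw [← Finsupp.mapDomain_comp, ← Finsupp.mapDomain_comp]
      exact congrArg (fun u => Finsupp.mapDomain u (Elt.coeff p)) (funext (hs s)))⟩ :
    Hom X.free Y.free)

theorem freeMap_elt (t : X.carrier → Y.carrier) (hs : ∀ s x, t (X.act s x) = Y.act s (t x))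
    (hd : ∀ x, X.dom x * Y.dom (t x) = X.dom x) {e : Idem S} {c : X.carrier →₀ ℤ}
    (hc : c ∈ X.supported e) : freeMap t hs hd (elt e c hc) = elt e (c.mapDomain t)
      (mapDomain_mem_supported Y (fun x h => Idem.le_trans h (hd x)) hc) := rfl

theorem freeMap_basis (t : X.carrier → Y.carrier) (hs : ∀ s x, t (X.act s x) = Y.act s (t x))
    (hd : ∀ x, X.dom x * Y.dom (t x) = X.dom x) (x : X.carrier) :
    freeMap t hs hd (basis x) = Y.free.alpha (X.dom x) * basis (t x) := by
  rw [basis, freeMap_elt, basis, alpha_mul_elt]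
  exact Elt.ext (hd x).symm Finsupp.mapDomain_single

/-! ### The universal property of free modules -/

section Lift

variable {A : LauschMod S} (b : X.carrier → A) (hb : ∀ x, supp (b x) = X.dom x)

open Classical in
/-- The image of the generator `x` in the component `A_e`, for `e ≤ dom x`. -/
noncomputable def liftGen (e : Idem S) (x : X.carrier) : Comp A e :=
  if h : e * X.dom x = e then
    ⟨A.alpha e * b x, by rw [supp_mul, supp_alpha, hb, h]⟩
  else 0

theorem val_liftGen {e : Idem S} {x : X.carrier} (h : e * X.dom x = e) :
    (liftGen b hb e x).1 = A.alpha e * b x := by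
  rw [liftGen, dif_pos h]

/-- The image of a combination of generators in the component `A_e`. -/
noncomputable def liftComp (e : Idem S) : (X.carrier →₀ ℤ) →+ Comp A e :=
  Finsupp.liftAddHom fun x => zmultiplesHom _ (liftGen b hb e x)

/-- Serves twice: with `t = id` for restriction to a smaller component, and with `t` the action of
`s` for equivariance under `λ_s`. -/
theorem map_liftComp {e e' : Idem S} (φ : Comp A e →+ Comp A e') (t : X.carrier → X.carrier)
    (h : ∀ x, e * X.dom x = e → φ (liftGen b hb e x) = liftGen b hb e' (t x))
    {c : X.carrier →₀ ℤ} (hc : c ∈ X.supported e) :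
    φ (liftComp b hb e c) = liftComp b hb e' (c.mapDomain t) := by
  rw [supported_eq_closure] at hc
  induction hc using AddSubgroup.closure_induction with
  | mem c hx =>
    obtain ⟨x, hx, rfl⟩ := hx
    simp only [liftComp, Finsupp.mapDomain_single, Finsupp.liftAddHom_apply_single,
      zmultiplesHom_apply, one_zsmul, h x hx]
  | zero => simp
  | add c d _ _ ihc ihd => rw [map_add, map_add, ihc, ihd, Finsupp.mapDomain_add, map_add]
  | neg c _ ih =>
    rw [map_neg, map_neg, ih, ← map_neg]
    congr 1
    exact (map_neg (Finsupp.mapDomain.addMonoidHom t) c).symm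

theorem alpha_mul_liftComp (e f : Idem S) {c : X.carrier →₀ ℤ} (hc : c ∈ X.supported e) :
    A.alpha f * (liftComp b hb e c).1 = (liftComp b hb (e * f) c).1 := by
  have h := map_liftComp b hb (e' := e * f)
    (Comp.map (A.lam f.1) fun a ha => by rw [supp_lam, ha, Idem.conj_idem, mul_comm]) id
    (fun x hx => Comp.ext (by
      have hx' : e * f * X.dom x = e * f := by rw [mul_right_comm, hx]
      rw [Comp.val_map, val_liftGen b hb hx, id_eq, val_liftGen b hb hx', A.str.lam_idem, ← mul_assoc, ← map_mul,
        mul_comm f])) hc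
  rw [Finsupp.mapDomain_id] at h
  have := congrArg Comp.val h
  rwa [Comp.val_map, A.str.lam_idem] at this

/-- Both factors may be restricted to the component of `e f`, where `liftComp` is additive. -/
theorem liftComp_add (e f : Idem S) {c d : X.carrier →₀ ℤ} (hc : c ∈ X.supported e)
    (hd : d ∈ X.supported f) : (liftComp b hb (e * f) (c + d)).1 =
      (liftComp b hb e c).1 * (liftComp b hb f d).1 := by
  rw [map_add, Comp.val_add, ← alpha_mul_liftComp b hb _ _ hc, mul_comm e,
    ← alpha_mul_liftComp b hb _ _ hd]
  have h1 := alpha_mul_eq (liftComp b hb e c).2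
  have h2 := alpha_mul_eq (liftComp b hb f d).2
  generalize (liftComp b hb e c).1 = x at *
  generalize (liftComp b hb f d).1 = y at *
  calc _ = (A.alpha e * x) * (A.alpha f * y) := by ac_rfl
    _ = _ := by rw [h1, h2]

theorem lam_liftComp
    (hs : ∀ s x, A.alpha (Idem.conj s (X.dom x)) * b (X.act s x) = A.lam s (b x))
    (s : S) (e : Idem S) {c : X.carrier →₀ ℤ} (hc : c ∈ X.supported e) :
    A.lam s (liftComp b hb e c).1 = (liftComp b hb (Idem.conj s e) (c.mapDomain (X.act s))).1 :=
  congrArg Comp.val (map_liftComp b hb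
    (Comp.map (A.lam s) fun a ha => by rw [supp_lam, ha]) (X.act s)
    (fun x hx => Comp.ext (by
      rw [Comp.val_map, val_liftGen b hb hx, val_liftGen b hb (X.le_dom_act s hx), map_mul,
        A.str.lam_alpha, ← hs, ← mul_assoc, ← map_mul, Idem.conj_le_conj s hx])) hc)

/-- The morphism from a free module with prescribed values on the generators. -/
noncomputable def freeLift
    (hs : ∀ s x, A.alpha (Idem.conj s (X.dom x)) * b (X.act s x) = A.lam s (b x)) : X.free ⟶ A :=
  (⟨⟨fun p => (liftComp b hb (Elt.idx p) (Elt.coeff p)).1,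
      fun p q => liftComp_add b hb _ _ (Elt.mem p) (Elt.mem q)⟩,
    fun e => congrArg Comp.val (map_zero (liftComp b hb e)),
    fun s p => (lam_liftComp b hb hs s _ (Elt.mem p)).symm⟩ : Hom X.free A)

theorem freeLift_basis
    (hs : ∀ s x, A.alpha (Idem.conj s (X.dom x)) * b (X.act s x) = A.lam s (b x))
    (x : X.carrier) : freeLift b hb hs (basis x) = b x := by
  change (liftComp b hb (X.dom x) (Finsupp.single x 1)).1 = _
  rw [liftComp, Finsupp.liftAddHom_apply_single, zmultiplesHom_apply, one_zsmul,
    val_liftGen b hb (Idem.mul_self _), alpha_mul_eq (hb x)]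

end Lift

end DomSet

/-! ### Elementwise exactness and augmentations -/

namespace LauschMod

theorem exact_of_exists {A B C : LauschMod S} (f : A ⟶ B) (g : B ⟶ C) (w : f ≫ g = 0)
    (h : ∀ b, g b = C.alpha (supp b) → ∃ a, f a = b) : (ShortComplex.mk f g w).Exact := by
  rw [ShortComplex.exact_iff_kernel_ι_comp_cokernel_π_zero]
  ext k
  change Limits.cokernel.π f (Limits.kernel.ι g k) = _
  obtain ⟨a, ha⟩ := h (Limits.kernel.ι g k) (by
    rw [← comp_apply, Limits.kernel.condition, zero_apply, supp_hom])
  rw [zero_apply, ← ha, ← comp_apply, Limits.cokernel.condition, zero_apply]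
  congr 1
  rw [← supp_hom f, ha]
  exact supp_hom (Limits.kernel.ι g) k

/-- The evaluation at an element, as a homomorphism from the group of morphisms. -/
noncomputable def evalHom {A : LauschMod S} (B : LauschMod S) (a : A) {e : Idem S}
    (h : supp a = e) : (A ⟶ B) →+ Comp B e :=
  AddMonoidHom.mk' (fun f => ⟨f a, (supp_hom f a).trans h⟩) fun _ _ => Comp.ext rfl

end LauschMod

open LauschMod

namespace DomSet

/-- The second component of the value at a given element, as a homomorphism from the group of
morphisms into a free module. -/
noncomputable def coeffHom {A : LauschMod S} (X : DomSet S) (a : A) :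
    (A ⟶ X.free) →+ (X.carrier →₀ ℤ) :=
  AddMonoidHom.mk' (fun f => Elt.coeff (f a)) fun _ _ => rfl

theorem coeffHom_apply {A : LauschMod S} {X : DomSet S} (a : A) (f : A ⟶ X.free) :
    coeffHom X a f = Elt.coeff (f a) := rfl

theorem supp_eq_idx {X : DomSet S} (p : X.free) : supp p = Elt.idx p :=
  supp_elt (Elt.mem p)

/-- The augmentation of a free module. -/
noncomputable def augmentation (X : DomSet S) : X.free ⟶ trivialModule S :=
  (⟨⟨fun p => (Multiplicative.ofAdd (Finsupp.liftAddHom (fun _ => AddMonoidHom.id ℤ)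
        (Elt.coeff p)), Elt.idx p),
      fun p q => Prod.ext (congrArg Multiplicative.ofAdd (map_add _ (Elt.coeff p) (Elt.coeff q)))
        rfl⟩,
    fun _ => Prod.ext (congrArg Multiplicative.ofAdd (map_zero _)) rfl,
    fun s p => Prod.ext (congrArg Multiplicative.ofAdd (by
      change Finsupp.liftAddHom _ (Finsupp.mapDomain (X.act s) (Elt.coeff p)) = _
      simp only [Finsupp.liftAddHom_apply]
      exact Finsupp.sum_mapDomain_index (fun _ => rfl) (fun _ _ _ => rfl))) rfl⟩ :
    Hom X.free (trivialModule S))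

theorem augmentation_elt {X : DomSet S} {e : Idem S} {c : X.carrier →₀ ℤ}
    (hc : c ∈ X.supported e) : X.augmentation (elt e c hc) =
      (Multiplicative.ofAdd (Finsupp.liftAddHom (fun _ => AddMonoidHom.id ℤ) c), e) := rfl

theorem freeMap_augmentation {X Y : DomSet S} (t : X.carrier → Y.carrier)
    (hs : ∀ s x, t (X.act s x) = Y.act s (t x)) (hd : ∀ x, X.dom x * Y.dom (t x) = X.dom x) :
    freeMap t hs hd ≫ Y.augmentation = X.augmentation := by
  apply free_hom_ext
  intro x
  rw [LauschMod.comp_apply, basis, freeMap_elt, augmentation_elt, augmentation_elt, Finsupp.mapDomain_single,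
    Finsupp.liftAddHom_apply_single, Finsupp.liftAddHom_apply_single]

end DomSet

open DomSet

/-! ### Tuples of elements of the maximum group image -/

variable (hF : IsFInverse S)

/-- The set `G^ι` with the diagonal action of `S`, where `G` is the maximum group image. -/
noncomputable abbrev tuples (ι : Type) [Fintype ι] : DomSet S where
  carrier := ι → MaxGroupImage S
  act s g i := toGroup S s * g i
  act_idem e g := funext fun i => by rw [toGroup_idem e.2, one_mul]
  act_mul s t g := funext fun i => by rw [map_mul, mul_assoc]
  dom g := ∏ i, oneI hF (g i)
  -- Being below a meet is checked entrywise, where it is `s 1_{g_i} s⁻¹ ≤ 1_{[s] g_i}`.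
  conj_dom_mul s g := (Idem.le_prod_iff _ _ _).2 fun i hi =>
    Idem.le_trans (Idem.conj_le_conj s ((Idem.le_prod_iff _ _ _).1 (Idem.mul_self _) i hi))
      (conj_oneI_mul hF s (g i))

section Tuples

variable {ι κ : Type} [Fintype ι] [Fintype κ]

theorem tuples_act (s : S) (g : ι → MaxGroupImage S) (i : ι) :
    (tuples hF ι).act s g i = toGroup S s * g i := rfl

theorem le_tuples_dom_iff {e : Idem S} {g : ι → MaxGroupImage S} :
    e * (tuples hF ι).dom g = e ↔ ∀ i, e * oneI hF (g i) = e :=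
  (Idem.le_prod_iff _ _ _).trans (by simp)

theorem tuples_dom_mul_oneI (g : ι → MaxGroupImage S) (i : ι) :
    (tuples hF ι).dom g * oneI hF (g i) = (tuples hF ι).dom g :=
  (le_tuples_dom_iff hF).1 (Idem.mul_self _) i

/-- Forgetting or repeating entries imposes no new conditions, so the domain can only grow; this is
what makes reindexing a morphism. -/
theorem tuples_dom_mul_comp (t : κ → ι) (g : ι → MaxGroupImage S) :
    (tuples hF ι).dom g * (tuples hF κ).dom (g ∘ t) = (tuples hF ι).dom g :=
  (le_tuples_dom_iff hF).2 fun i => tuples_dom_mul_oneI hF g (t i)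

/-- The map of sets of tuples given by a map of index sets. -/
def precomp (t : κ → ι) (g : (tuples hF ι).carrier) : (tuples hF κ).carrier := fun k => g (t k)

/-- The morphism of free modules given by a map of index sets. -/
noncomputable def reindex (t : κ → ι) : (tuples hF ι).free ⟶ (tuples hF κ).free :=
  freeMap (precomp hF t) (fun _ _ => rfl) (tuples_dom_mul_comp hF t)

theorem coeff_reindex (t : κ → ι) (p : (tuples hF ι).free) :
    Elt.coeff (reindex hF t p) = Finsupp.mapDomain (precomp hF t) (Elt.coeff p) := rfl

theorem reindex_basis (t : κ → ι) (g : (tuples hF ι).carrier) : reindex hF t (basis g) =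
    (tuples hF κ).free.alpha ((tuples hF ι).dom g) * basis (precomp hF t g) :=
  freeMap_basis _ _ _ _

theorem reindex_id : reindex hF (id : ι → ι) = 𝟙 _ := by
  ext p
  exact Elt.ext rfl Finsupp.mapDomain_id

theorem reindex_comp {μ : Type} [Fintype μ] (t : κ → ι) (t' : μ → κ) :
    reindex hF t ≫ reindex hF t' = reindex hF (t ∘ t') := by
  ext p
  exact Elt.ext rfl Finsupp.mapDomain_comp.symm

theorem reindex_augmentation (t : κ → ι) :
    reindex hF t ≫ (tuples hF κ).augmentation = (tuples hF ι).augmentation :=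
  freeMap_augmentation _ _ _

/-- A converse of `conj_dom_mul`, valid for `dom g ≤ 1_x`: translate `g` back by `m_x⁻¹`, bound the
domain there, and conjugate by `m_x`. -/
theorem tuples_dom_mul_conj {x : MaxGroupImage S} {p g : ι → MaxGroupImage S}
    (hg : ∀ i, g i = x * p i) (hx : (tuples hF ι).dom g * oneI hF x = (tuples hF ι).dom g) :
    (tuples hF ι).dom g * Idem.conj (maxElt hF x) ((tuples hF ι).dom p) = (tuples hF ι).dom g := by
  have h := (tuples hF ι).conj_dom_mul (maxElt hF x⁻¹) g
  have hp : (tuples hF ι).act (maxElt hF x⁻¹) g = p := funext fun i => by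
    rw [tuples_act, toGroup_maxElt, hg, inv_mul_cancel_left]
  rw [hp] at h
  have h' := Idem.conj_le_conj (maxElt hF x) h
  rw [maxElt_inv, Idem.conj_conj_sinv, ← oneI, mul_comm (oneI hF x), hx] at h'
  exact h'

end Tuples

/-! ### The simplicial module of tuples -/

/-- The simplicial module with the free module on `G^{n+1}` in degree `n`. -/
noncomputable def tuplesSimplicial : SimplicialObject (LauschMod S) where
  obj k := (tuples hF (Fin (k.unop.len + 1))).free
  map f := reindex hF f.unop.toOrderHom
  map_id k := by
    have h : (SimplexCategory.Hom.toOrderHom (𝟙 k : k ⟶ k).unop : _ → _) = id := rfl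
    rw [h, reindex_id]
  map_comp f g := by
    have h : (SimplexCategory.Hom.toOrderHom (f ≫ g).unop : _ → _) =
      SimplexCategory.Hom.toOrderHom f.unop ∘ SimplexCategory.Hom.toOrderHom g.unop := rfl
    rw [h, reindex_comp]

/-- The differential of the complex of free modules on the sets `G^{n+1}`. -/
noncomputable def tuplesD (n : ℕ) :
    (tuples hF (Fin (n + 2))).free ⟶ (tuples hF (Fin (n + 1))).free :=
  ∑ i : Fin (n + 2), (-1 : ℤ) ^ (i : ℕ) • reindex hF i.succAbove

/-- The simplicial identities do the work: `tuplesD` is the alternating sum of the faces of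
`tuplesSimplicial`. -/
theorem tuplesD_comp_tuplesD (n : ℕ) : tuplesD hF (n + 1) ≫ tuplesD hF n = 0 :=
  AlgebraicTopology.AlternatingFaceMapComplex.d_squared (tuplesSimplicial hF) n

/-- The complex of free modules on the sets `G^{n+1}`. -/
noncomputable abbrev tuplesComplex : ChainComplex (LauschMod S) ℕ :=
  ChainComplex.of (fun n => (tuples hF (Fin (n + 1))).free) (tuplesD hF) (tuplesD_comp_tuplesD hF)

theorem tuplesComplex_d (n : ℕ) : (tuplesComplex hF).d (n + 1) n = tuplesD hF n :=
  ChainComplex.of_d (fun n => (tuples hF (Fin (n + 1))).free) (tuplesD hF) n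

/-! ### Exactness -/

/-- The alternating sum of the maps forgetting an entry. -/
noncomputable def boundary (n : ℕ) :
    ((tuples hF (Fin (n + 1))).carrier →₀ ℤ) →+ ((tuples hF (Fin n)).carrier →₀ ℤ) :=
  ∑ i : Fin (n + 1), (-1 : ℤ) ^ (i : ℕ) •
    Finsupp.mapDomain.addMonoidHom (precomp hF i.succAbove)

theorem boundary_apply (n : ℕ) (c : (tuples hF (Fin (n + 1))).carrier →₀ ℤ) :
    boundary hF n c = ∑ i : Fin (n + 1), (-1 : ℤ) ^ (i : ℕ) •
      Finsupp.mapDomain (precomp hF i.succAbove) c := by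
  rw [boundary, AddMonoidHom.finsetSum_apply]
  rfl

/-- The index shifts by one because `boundary` also has a term `boundary 0` into the empty tuple,
which stands in for the augmentation. -/
theorem coeff_tuplesD (n : ℕ) (p : (tuples hF (Fin (n + 2))).free) :
    Elt.coeff (tuplesD hF n p) = boundary hF (n + 1) (Elt.coeff p) := by
  rw [tuplesD, ← coeffHom_apply, map_sum, boundary_apply]
  refine Finset.sum_congr rfl fun i _ => ?_
  rw [map_zsmul, coeffHom_apply, coeff_reindex]

/-- The map prepending the entry `1` to a tuple. -/
def cone (n : ℕ) (g : (tuples hF (Fin n)).carrier) : (tuples hF (Fin (n + 1))).carrier :=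
  fun i => Fin.cons (α := fun _ => MaxGroupImage S) 1 g i

theorem le_dom_cone {n : ℕ} {e : Idem S} {g : (tuples hF (Fin n)).carrier}
    (h : e * (tuples hF (Fin n)).dom g = e) :
    e * (tuples hF (Fin (n + 1))).dom (cone hF n g) = e := by
  refine (le_tuples_dom_iff hF).2 fun i => ?_
  refine Fin.cases ?_ (fun i => ?_) i
  · change e * oneI hF 1 = e
    rw [oneI_one, mul_one]
  · exact (le_tuples_dom_iff hF).1 h i

theorem precomp_cone (n : ℕ) (i : Fin (n + 1)) (g : (tuples hF (Fin (n + 1))).carrier) :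
    precomp hF i.succ.succAbove (cone hF (n + 1) g) = cone hF n (precomp hF i.succAbove g) := by
  funext j
  refine Fin.cases ?_ (fun j => ?_) j
  · rfl
  · simp only [precomp, cone, Fin.succ_succAbove_succ]
    rfl

/-- The contracting homotopy: face `0` removes the new entry `1`, while face `i + 1` of the cone is
the cone of face `i`, with opposite sign. -/
theorem boundary_cone (n : ℕ) (c : (tuples hF (Fin (n + 1))).carrier →₀ ℤ) :
    boundary hF (n + 1) (c.mapDomain (cone hF (n + 1))) =
      c - (boundary hF n c).mapDomain (cone hF n) := by
  have hm (d : (tuples hF (Fin n)).carrier →₀ ℤ) : d.mapDomain (cone hF n) =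
    Finsupp.mapDomain.addMonoidHom (cone hF n) d := rfl
  rw [boundary_apply, boundary_apply, Fin.sum_univ_succ, hm, map_sum, sub_eq_add_neg,
    ← Finset.sum_neg_distrib]
  congr 1
  · rw [Fin.val_zero, pow_zero, one_zsmul, ← Finsupp.mapDomain_comp]
    exact Finsupp.mapDomain_id
  · refine Finset.sum_congr rfl fun i _ => ?_
    rw [map_zsmul, ← hm, ← Finsupp.mapDomain_comp, ← Finsupp.mapDomain_comp, Fin.val_succ, pow_succ,
      mul_neg_one, neg_zsmul]
    congr 3
    exact funext (precomp_cone hF n i)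

theorem exists_boundary_eq (n : ℕ) {e : Idem S} {c : (tuples hF (Fin (n + 1))).carrier →₀ ℤ}
    (hc : c ∈ (tuples hF (Fin (n + 1))).supported e) (h : boundary hF n c = 0) :
    ∃ d ∈ (tuples hF (Fin (n + 2))).supported e, boundary hF (n + 1) d = c :=
  ⟨c.mapDomain (cone hF (n + 1)),
    mapDomain_mem_supported _ (fun _ => le_dom_cone hF) hc,
    by rw [boundary_cone, h, Finsupp.mapDomain_zero, sub_zero]⟩

/-- Since `1_1 = 1`, coning off does not leave the component of `p`, so a cycle bounds over its own
index. -/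
theorem exists_tuplesD_eq (n : ℕ) {p : (tuples hF (Fin (n + 1))).free}
    (h : boundary hF n (Elt.coeff p) = 0) : ∃ q, tuplesD hF n q = p := by
  obtain ⟨d, hd, hdp⟩ := exists_boundary_eq hF n (Elt.mem p) h
  refine ⟨elt (Elt.idx p) d hd, Elt.ext ?_ ((coeff_tuplesD hF n _).trans hdp)⟩
  rw [← supp_eq_idx, supp_hom, supp_elt]

theorem tuplesD_comp_augmentation : tuplesD hF 0 ≫ (tuples hF (Fin 1)).augmentation = 0 := by
  rw [tuplesD, Preadditive.sum_comp, Fin.sum_univ_two]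
  simp only [Preadditive.zsmul_comp, reindex_augmentation]
  simp

theorem boundary_zero_eq_zero {c : (tuples hF (Fin 1)).carrier →₀ ℤ}
    (h : Finsupp.liftAddHom (fun _ => AddMonoidHom.id ℤ) c = 0) : boundary hF 0 c = 0 := by
  -- There is a single empty tuple, so `boundary 0` only records the sum of the coefficients.
  have hu : ∀ x y : (tuples hF (Fin 0)).carrier, x = y := fun x y => funext fun i => i.elim0
  rw [boundary_apply, Fin.sum_univ_one, Fin.val_zero, pow_zero, one_zsmul]
  have h2 : Finsupp.liftAddHom (fun _ => AddMonoidHom.id ℤ)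
      (Finsupp.mapDomain (precomp hF (0 : Fin 1).succAbove) c) = 0 := by
    rw [← h]
    simp only [Finsupp.liftAddHom_apply]
    exact Finsupp.sum_mapDomain_index (fun _ => rfl) (fun _ _ _ => rfl)
  generalize Finsupp.mapDomain (precomp hF (0 : Fin 1).succAbove) c = d at h2
  refine Finsupp.ext fun x => ?_
  have hd : d = Finsupp.single x (d x) := by
    refine Finsupp.ext fun y => ?_
    rw [hu y x, Finsupp.single_eq_same]
  rw [hd, Finsupp.liftAddHom_apply_single] at h2
  exact h2

theorem complex_d_comp_augmentation :
    (tuplesComplex hF).d 1 0 ≫ (tuples hF (Fin 1)).augmentation = 0 := by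
  rw [tuplesComplex_d, tuplesD_comp_augmentation]

theorem exact_augmentation : (ShortComplex.mk _ _ (complex_d_comp_augmentation hF)).Exact :=
  exact_of_exists _ _ _ fun _ h => by
    rw [tuplesComplex_d]
    exact exists_tuplesD_eq hF 0 (boundary_zero_eq_zero hF (congrArg Prod.fst h))

theorem exact_tuplesComplex (n : ℕ) :
    (ShortComplex.mk _ _ ((tuplesComplex hF).d_comp_d (n + 2) (n + 1) n)).Exact :=
  exact_of_exists _ _ _ fun p h => by
    rw [tuplesComplex_d] at h ⊢
    exact exists_tuplesD_eq hF (n + 1) ((coeff_tuplesD hF n p).symm.trans (congrArg Elt.coeff h))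

theorem augmentation_surjective : Function.Surjective (tuples hF (Fin 1)).augmentation := by
  rintro ⟨n, e⟩
  -- The tuple `(1)` has domain `1` and is therefore available over every `e`.
  have h : e * (tuples hF (Fin 1)).dom (fun _ => 1) = e :=
    (le_tuples_dom_iff hF).2 fun _ => by rw [oneI_one, mul_one]
  refine ⟨elt e (Finsupp.single _ n.toAdd) (single_mem_supported h _), ?_⟩
  rw [augmentation_elt, Finsupp.liftAddHom_apply_single]
  rfl

/-! ### The universal property of the modules of tuples -/

/-- The generator `(1, x_1, x_1 x_2, …)` of the module of tuples. -/
noncomputable def gen {n : ℕ} (x : Fin n → MaxGroupImage S) : (tuples hF (Fin (n + 1))).free :=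
  basis (X := tuples hF (Fin (n + 1))) (Fin.partialProd x)

/-- The index of the generator `(1, x_1, x_1 x_2, …)`. -/
noncomputable def genDom {n : ℕ} (x : Fin n → MaxGroupImage S) : Idem S :=
  (tuples hF (Fin (n + 1))).dom (Fin.partialProd x)

theorem supp_gen {n : ℕ} (x : Fin n → MaxGroupImage S) : supp (gen hF x) = genDom hF x :=
  supp_basis _

/-- The successive quotients of the entries of a tuple. -/
noncomputable def quotients {n : ℕ} (g : (tuples hF (Fin (n + 1))).carrier) :
    Fin n → MaxGroupImage S :=
  fun i => (g i.castSucc)⁻¹ * g i.succ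

theorem eq_mul_partialProd {n : ℕ} (g : (tuples hF (Fin (n + 1))).carrier) (i : Fin (n + 1)) :
    g i = g 0 * Fin.partialProd (quotients hF g) i :=
  (congrFun (Fin.partialProd_left_inv (G := MaxGroupImage S) g) i).symm

theorem dom_mul_conj_genDom {n : ℕ} (g : (tuples hF (Fin (n + 1))).carrier) :
    (tuples hF (Fin (n + 1))).dom g * Idem.conj (maxElt hF (g 0)) (genDom hF (quotients hF g)) =
      (tuples hF (Fin (n + 1))).dom g :=
  tuples_dom_mul_conj hF (eq_mul_partialProd hF g) (tuples_dom_mul_oneI hF g 0)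

/-- The passage from homogeneous to inhomogeneous coordinates. The translate by `m_{g_0}` is defined
on all of `dom g`, so no part of the basis element is lost. -/
theorem basis_eq_lam_gen {n : ℕ} (g : (tuples hF (Fin (n + 1))).carrier) :
    basis g = (tuples hF (Fin (n + 1))).free.alpha ((tuples hF (Fin (n + 1))).dom g) *
      (tuples hF (Fin (n + 1))).free.lam (maxElt hF (g 0)) (gen hF (quotients hF g)) := by
  have hg : (tuples hF (Fin (n + 1))).act (maxElt hF (g 0)) (Fin.partialProd (quotients hF g)) =
      g := funext fun i => by rw [tuples_act, toGroup_maxElt, ← eq_mul_partialProd]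
  rw [gen, lam_basis, hg, ← mul_assoc, ← map_mul]
  erw [dom_mul_conj_genDom]
  exact (alpha_mul_eq (supp_basis g)).symm

theorem tuples_hom_ext {n : ℕ} {A : LauschMod S} {f f' : (tuples hF (Fin (n + 1))).free ⟶ A}
    (h : ∀ x, f (gen hF x) = f' (gen hF x)) : f = f' := by
  apply free_hom_ext
  intro g
  rw [basis_eq_lam_gen, hom_mul, hom_mul, hom_alpha, hom_alpha, hom_lam, hom_lam, h]

section Lift

variable {n : ℕ} {A : LauschMod S} (c : (Fin n → MaxGroupImage S) → A)

/-- The image of a tuple under the morphism with prescribed values on the generators. -/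
noncomputable def tuplesLiftFun (g : (tuples hF (Fin (n + 1))).carrier) : A :=
  A.alpha ((tuples hF (Fin (n + 1))).dom g) * A.lam (maxElt hF (g 0)) (c (quotients hF g))

variable (hc : ∀ x, supp (c x) = genDom hF x)

include hc in
theorem supp_tuplesLiftFun (g : (tuples hF (Fin (n + 1))).carrier) :
    supp (tuplesLiftFun hF c g) = (tuples hF (Fin (n + 1))).dom g := by
  rw [tuplesLiftFun, supp_mul, supp_alpha, supp_lam, hc, dom_mul_conj_genDom]

/-- Left translation leaves the successive quotients alone, and `s m_{g_0}` is the restriction of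
`m_{[s] g_0}` to `s 1_{g_0} s⁻¹`, which lies above `s (dom g) s⁻¹`. -/
theorem tuplesLiftFun_act (s : S) (g : (tuples hF (Fin (n + 1))).carrier) :
    A.alpha (Idem.conj s ((tuples hF (Fin (n + 1))).dom g)) *
      tuplesLiftFun hF c ((tuples hF (Fin (n + 1))).act s g) = A.lam s (tuplesLiftFun hF c g) := by
  have hq : quotients hF ((tuples hF (Fin (n + 1))).act s g) = quotients hF g :=
    funext fun i => by
      simp only [quotients, mul_inv_rev, mul_assoc, inv_mul_cancel_left]
  have h : Idem.conj s ((tuples hF (Fin (n + 1))).dom g) * Idem.conj s (oneI hF (g 0)) =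
      Idem.conj s ((tuples hF (Fin (n + 1))).dom g) :=
    Idem.conj_le_conj s (tuples_dom_mul_oneI hF g 0)
  rw [tuplesLiftFun, tuplesLiftFun, hq, map_mul, A.str.lam_alpha, A.str.lam_lam_maxElt hF,
    ← mul_assoc, ← map_mul, (tuples hF (Fin (n + 1))).conj_dom_mul, ← mul_assoc, ← map_mul, h,
    tuples_act]

/-- The morphism with prescribed values on the generators `(1, x_1, x_1 x_2, …)`. -/
noncomputable def tuplesLift : (tuples hF (Fin (n + 1))).free ⟶ A :=
  freeLift (tuplesLiftFun hF c) (supp_tuplesLiftFun hF c hc) (tuplesLiftFun_act hF c)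

theorem tuplesLift_gen (x : Fin n → MaxGroupImage S) :
    tuplesLift hF c hc (gen hF x) = c x := by
  rw [tuplesLift, gen, freeLift_basis, tuplesLiftFun]
  have hq : quotients hF (Fin.partialProd x) = x :=
    funext fun i => Fin.partialProd_right_inv x i
  rw [hq, Fin.partialProd_zero, maxElt_one, A.str.lam_one]
  exact alpha_mul_eq (hc x)

end Lift

/-- Epimorphisms are surjective and morphisms preserve `supp`, so arbitrary preimages of the values
on the `gen x` lie in the components required by `tuplesLift`. -/
instance (n : ℕ) : Projective (tuples hF (Fin (n + 1))).free where
  factors {E X} f e _ := by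
    choose b hb using fun x => surjective_of_epi e (f (gen hF x))
    refine ⟨tuplesLift hF b fun x => ?_, tuples_hom_ext hF fun x => ?_⟩
    · rw [← supp_hom e, hb, supp_hom, supp_gen]
    · rw [LauschMod.comp_apply, tuplesLift_gen, hb]

/-- The projective resolution of the trivial module by free modules on tuples. -/
noncomputable def tuplesResolution : ProjectiveResolution (trivialModule S) :=
  projectiveResolutionOfExact (tuplesComplex hF)
    (fun n => inferInstanceAs (Projective (tuples hF (Fin (n + 1))).free))
    (tuples hF (Fin 1)).augmentation (complex_d_comp_augmentation hF) (exact_augmentation hF)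
    (epi_of_surjective _ (augmentation_surjective hF)) (exact_tuplesComplex hF)

/-! ### Cochains as morphisms -/

/-- The component `A_e` is the group of units of the ideal `α(e) A`. -/
noncomputable def compAddEquivUnits {A : LauschMod S} {e : Idem S} {a : A} (h : A.alpha e = a)
    (ha : IsIdempotentElem a) : Comp A e ≃+ Additive (Corner a ha)ˣ where
  toFun b := Additive.ofMul
    { val := ⟨b.1, b.1, by rw [← h, alpha_mul_eq b.2]⟩
      inv := ⟨sinv b.1, sinv b.1, by rw [← h, alpha_mul_eq ((supp_sinv _).trans b.2)]⟩
      val_inv := Subtype.ext (by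
        change b.1 * sinv b.1 = a
        rw [← alpha_supp, b.2, h])
      inv_val := Subtype.ext (by
        change sinv b.1 * b.1 = a
        rw [mul_comm, ← alpha_supp, b.2, h]) }
  invFun u := ⟨u.toMul.1.1, by
    -- Invertibility gives `e ≤ supp u`, and membership in the ideal gives `supp u ≤ e`.
    have h1 : u.toMul.1.1 * u.toMul.2.1 = a := congrArg Subtype.val u.toMul.val_inv
    have h2 : a * u.toMul.1.1 = u.toMul.1.1 := mul_eq_of_mem_idealOf ha u.toMul.1.2
    have hs : supp a = e := by rw [← h, supp_alpha]
    have h3 := congrArg supp h1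
    have h4 := congrArg supp h2
    rw [supp_mul, hs] at h3 h4
    rw [← h4, ← h3, mul_right_comm, Idem.mul_self]⟩
  left_inv _ := rfl
  right_inv _ := Units.ext rfl
  map_add' _ _ := Units.ext rfl

section Cochain

variable (hF : IsFInverse S) (A : LauschMod S)

/-- The domain has `n + 1` factors and `e_n` only `n`; the additional one is `1_1 = 1`. -/
theorem alpha_genDom {n : ℕ} (x : Fin n → MaxGroupImage S) :
    A.alpha (genDom hF x) = (A.str.partialModule hF).e x := by
  change A.alpha (∏ i, oneI hF (Fin.partialProd x i)) = _
  rw [Fin.prod_univ_succ, Fin.partialProd_zero, oneI_one, one_mul, map_prod]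
  rfl

/-- The cochain given by a morphism from a module of tuples. -/
noncomputable def toCochain (n : ℕ) : ((tuples hF (Fin (n + 1))).free ⟶ A) →+
    Additive ((A.str.partialModule hF).Cochain n) :=
  AddMonoidHom.mk' (fun f => Additive.ofMul fun x =>
    (compAddEquivUnits (alpha_genDom hF A x) ((A.str.partialModule hF).idem_e x)
      (evalHom A (gen hF x) (supp_gen hF x) f)).toMul) fun f g => by
    refine congrArg Additive.ofMul (funext fun x => ?_)
    rw [map_add, map_add]
    rfl

theorem val_toCochain {n : ℕ} (f : (tuples hF (Fin (n + 1))).free ⟶ A)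
    (x : Fin n → MaxGroupImage S) : ((toCochain hF A n f).toMul x).1.1 = f (gen hF x) := rfl

theorem toCochain_bijective (n : ℕ) : Function.Bijective (toCochain hF A n) := by
  constructor
  · intro f g h
    refine tuples_hom_ext hF fun x => ?_
    rw [← val_toCochain, h, val_toCochain]
  · intro c
    let b (x) := (compAddEquivUnits (alpha_genDom hF A x)
      ((A.str.partialModule hF).idem_e x)).symm (Additive.ofMul (c.toMul x))
    refine ⟨tuplesLift hF (fun x => (b x).1) fun x => (b x).2, ?_⟩
    refine congrArg Additive.ofMul (funext fun x => Units.ext (Subtype.ext ?_))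
    exact tuplesLift_gen hF _ _ x

/-- The cochains are the morphisms from the modules of tuples. -/
noncomputable def cochainEquiv (n : ℕ) : ((tuples hF (Fin (n + 1))).free ⟶ A) ≃+
    Additive ((A.str.partialModule hF).Cochain n) :=
  AddEquiv.ofBijective _ (toCochain_bijective hF A n)

theorem conj_genDom_tail {n : ℕ} (x : Fin (n + 1) → MaxGroupImage S) :
    Idem.conj (maxElt hF (x 0)) (genDom hF (Fin.tail x)) = genDom hF x := by
  -- Injectivity of `α` for one strict module transfers the identity `act_e_tail` to `E(S)`.
  apply (trivialModule S).alpha_injective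
  rw [← SModule.lam_alpha, ← SModule.partialModule_act _ hF, alpha_genDom, alpha_genDom]
  exact PartialModule.act_e_tail _ x

/-- Without its first entry, `(1, x_1, x_1 x_2, …)` is the `x_1`-translate of `(1, x_2, x_2 x_3,
…)`: the source of the term with `θ_{x_1}` in `δ^n`. -/
theorem reindex_succAbove_zero_gen {n : ℕ} (x : Fin (n + 1) → MaxGroupImage S) :
    reindex hF (0 : Fin (n + 2)).succAbove (gen hF x) =
      (tuples hF (Fin (n + 1))).free.lam (maxElt hF (x 0)) (gen hF (Fin.tail x)) := by
  have h : (tuples hF (Fin (n + 1))).act (maxElt hF (x 0)) (Fin.partialProd (Fin.tail x)) =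
      precomp hF (0 : Fin (n + 2)).succAbove (Fin.partialProd x) := funext fun i => by
    rw [tuples_act, toGroup_maxElt, ← Fin.partialProd_succ']
    rfl
  rw [gen, gen, lam_basis, h, reindex_basis]
  congr 2
  exact (conj_genDom_tail hF x).symm

/-- Omitting an inner partial product merges two neighbouring variables, and omitting the last one
drops the last variable; `contractNth` covers both cases. -/
theorem reindex_succAbove_succ_gen {n : ℕ} (x : Fin (n + 1) → MaxGroupImage S) (j : Fin (n + 1)) :
    reindex hF j.succ.succAbove (gen hF x) =
      (tuples hF (Fin (n + 1))).free.alpha (genDom hF x) *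
        gen hF (j.contractNth (· * ·) x) := by
  rw [gen, gen, reindex_basis, Fin.partialProd_contractNth]
  rfl

theorem cochainEquiv_tuplesD_comp (n : ℕ) (f : (tuples hF (Fin (n + 1))).free ⟶ A) :
    (cochainEquiv hF A (n + 1) (tuplesD hF n ≫ f)).toMul =
      (A.str.partialModule hF).delta n (cochainEquiv hF A n f).toMul := by
  funext x
  let U : ((tuples hF (Fin (n + 2))).free ⟶ A) →+ Additive _ :=
    (compAddEquivUnits (alpha_genDom hF A x)
      ((A.str.partialModule hF).idem_e x)).toAddMonoidHom.comp
      (evalHom A (gen hF x) (supp_gen hF x))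
  change (U (tuplesD hF n ≫ f)).toMul = _
  -- Face `0` is split off to match the `θ`-factor; face `j + 1` carries the sign `(-1)^(j + 1)` of
  -- the `j`-th factor.
  rw [tuplesD, Preadditive.sum_comp, map_sum, Fin.sum_univ_succ, toMul_add, toMul_sum]
  refine congrArg₂ (· * ·) ?_ (Finset.prod_congr rfl fun j _ => ?_)
  · rw [Fin.val_zero, pow_zero, one_zsmul]
    refine Units.ext (Subtype.ext ?_)
    change f (reindex hF (0 : Fin (n + 2)).succAbove (gen hF x)) =
      (A.str.partialModule hF).act (x 0) (f (gen hF (Fin.tail x)))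
    rw [reindex_succAbove_zero_gen hF, hom_lam, A.str.partialModule_act]
  · rw [Preadditive.zsmul_comp, map_zsmul, toMul_zsmul, Fin.val_succ]
    refine congrArg (· ^ (-1 : ℤ) ^ (j.1 + 1)) (Units.ext (Subtype.ext ?_))
    change f (reindex hF j.succ.succAbove (gen hF x)) =
      (A.str.partialModule hF).e x * f (gen hF (j.contractNth (· * ·) x))
    rw [reindex_succAbove_succ_gen, hom_mul, hom_alpha, alpha_genDom]

end Cochain

theorem nonempty_lauschCohomology_addEquiv (hF : IsFInverse S) (A : LauschMod S) (n : ℕ) :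
    Nonempty (LauschCohomology A n ≃+ Additive ((A.str.partialModule hF).Cohomology n)) := by
  have hd (n : ℕ) (f : (tuples hF (Fin (n + 1))).free ⟶ A) :
      (cochainEquiv hF A (n + 1) ((tuplesResolution hF).complex.d (n + 1) n ≫ f)).toMul =
        (A.str.partialModule hF).delta n (cochainEquiv hF A n f).toMul := by
    rw [← cochainEquiv_tuplesD_comp, ← tuplesComplex_d]
    rfl
  refine nonempty_ext_addEquiv (tuplesResolution hF) (cochainEquiv hF A n) _ _ (fun f => ?_)
    fun f hf => ?_
  · refine (iff_of_eq (congrArg (· = 1) (hd n f).symm)).trans ?_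
    exact (cochainEquiv hF A (n + 1)).map_eq_zero_iff
  · cases n with
    | zero =>
      -- In degree `0` the coboundaries are trivial on both sides.
      rw [extMk_zero_eq_zero_iff]
      exact Subgroup.mem_bot.trans (cochainEquiv hF A 0).map_eq_zero_iff
    | succ n =>
      -- The class of `f` vanishes exactly when `f` factors through the differential, which under
      -- `cochainEquiv` means lying in the image of `δ^n`.
      rw [(tuplesResolution hF).extMk_eq_zero_iff f _ rfl hf n rfl]
      constructor
      · rintro ⟨c, hc⟩
        obtain ⟨g, rfl⟩ := (cochainEquiv hF A n).surjective (Additive.ofMul c)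
        exact ⟨g, (cochainEquiv hF A (n + 1)).injective ((hd n g).trans hc)⟩
      · rintro ⟨g, rfl⟩
        exact ⟨_, (hd n g).symm⟩

end PartialCohomology

theorem mainTheorem1 {S : Type u} [Monoid S] [IsInverseSemigroup S]
    (hF : IsFInverse S) (hgen : IsMaxGenerated S)
    {A : Type u} [CommMonoid A] [IsInverseSemigroup A] (M : SModule S A) (hM : M.IsStrict) :
    ∃ P : PartialModule (MaxGroupImage S) A, P.IsInverse ∧
      ∀ n : ℕ, Nonempty (LauschCohomology hM.toLauschMod n ≃+ Additive (P.Cohomology n)) :=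
  ⟨M.partialModule hF, M.partialModule_isInverse hF hM hgen,
    nonempty_lauschCohomology_addEquiv hF hM.toLauschMod⟩
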